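/- Let $q$ be a complex number with $0<|q|<1$. Write $(x;q)_n=\prod_{i=0}^{n-1}(1-q^ix)$, $(x;q)_\infty=\prod_{i\ge 0}(1-q^ix)$, $j(x;q)=(x;q)_\infty(q/x;q)_\infty(q;q)_\infty$, $J_{a,m}=j(q^a;q^m)$ and $\overline{J}_{a,m}=j(-q^a;q^m)$. Let $$\phi(q)=\sum_{n\ge0}\frac{q^{n^2}}{(-q^2;q^2)_n},\quad \nu(q)=\sum_{n\ge0}\frac{q^{n(n+1)}}{(-q;q^2)_{n+1}},\quad \overline{\phi}_0(q)=\sum_{n\ge0}q^n(-q;q)_{2n+1},\quad \overline{\phi}_1(q)=\sum_{n\ge0}q^n(-q;q)_{2n}.$$ Let $\mathrm{sg}(r)=1$ for $r\ge0$ and $\mathrm{sg}(r)=-1$ for $r<0$, and for $x,y\in\mathbb{C}\setminus\{0\}$ let $$f_{a,b,c}(x,y,q)=\sum_{\mathrm{sg}(r)=\mathrm{sg}(s)}\mathrm{sg}(r)(-1)^{r+s}x^ry^sq^{a\binom r2+brs+c\binom s2},$$ the sum being over pairs of integers $(r,s)$. Let $\sum^{*}_{n,j}$ denote $\sum_{n+j\ge0,\,n-j\ge0}-\sum_{n+j<0,\,n-j<0}$,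 the sums being over pairs of integers $(n,j)$. Then all the series involved converge (those over pairs of integers absolutely), and $$\begin{aligned} \overline{J}_{1,4}\,\phi(q)&=\sum_{n\ge0}(-1)^nq^{2n^2+n}(1+q^{2n+1})\sum_{j=-n}^n(-1)^jq^{-3j^2/2+j/2}\\ &=\sum\nolimits^{*}_{n,j}(-1)^{n+j}q^{2n^2+n-3j^2/2+j/2}=f_{1,7,1}(-q,-q^2,q)+q\,f_{1,7,1}(-q^3,-q^4,q),\\[4pt] \overline{J}_{1,4}\,\nu(q)&=\sum_{n\ge0}(-1)^nq^{2n^2+2n}\sum_{j=-n}^n(-1)^jq^{-3j^2/2+j/2}\\ &=\tfrac12\sum\nolimits^{*}_{n,j}(-1)^{n+j}q^{2n^2+2n-3j^2/2+j/2}=f_{1,7,1}(-q^2,-q^3,q),\\[4pt] J_{1,2}\,\bigl(q\overline{\phi}_0(q)+1\bigr)&=\sum_{n\ge0}q^{4n^2+n}(1-q^{6n+3})\sum_{j=-n}^n(-1)^jq^{-3j^2-j}\\ &=\sum\nolimits^{*}_{n,j}(-1)^{j}q^{4n^2+n-3j^2-j}=f_{1,7,1}(q,q^3,q^2)+q^5f_{1,7,1}(q^9,q^{11},q^2),\\[4pt]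 J_{1,2}\,\overline{\phi}_1(q)&=\sum_{n\ge0}q^{4n^2+3n}(1-q^{2n+1})\sum_{j=-n}^n(-1)^jq^{-3j^2-j}\\ &=\sum\nolimits^{*}_{n,j}(-1)^{j}q^{4n^2+3n-3j^2-j}=f_{1,7,1}(q^3,q^5,q^2)+q^7f_{1,7,1}(q^{11},q^{13},q^2). \end{aligned}$$ -/

import Mathlib

namespace HeckeMock

/-- The finite `q`-Pochhammer symbol `(x; q)_n = ∏_{i=0}^{n-1} (1 - q^i x)`. -/
noncomputable def qPoch (x q : ℂ) (n : ℕ) : ℂ := ∏ i ∈ Finset.range n, (1 - q ^ i * x)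

/-- The infinite `q`-Pochhammer symbol `(x; q)_∞ = ∏_{i ≥ 0} (1 - q^i x)`. -/
noncomputable def qPochInf (x q : ℂ) : ℂ := ∏' i : ℕ, (1 - q ^ i * x)

/-- The infinite product `(x; q)_∞` converges for `|q| < 1`, so that `qPochInf` is its value. -/
theorem multipliable_qPochInf (x q : ℂ) (hq : ‖q‖ < 1) :
    Multipliable (fun i : ℕ => 1 - q ^ i * x) := by
  have h : Summable (fun i : ℕ => ‖-(q ^ i * x)‖) := by
    simpa [norm_mul, norm_pow] using
      (summable_geometric_of_lt_one (norm_nonneg q) hq).mul_right ‖x‖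
  simpa [sub_eq_add_neg] using multipliable_one_add_of_summable h

/-- The theta function `j(x; q) = (x; q)_∞ (q/x; q)_∞ (q; q)_∞`. -/
noncomputable def jTheta (x q : ℂ) : ℂ := qPochInf x q * qPochInf (q / x) q * qPochInf q q

/-- `J_{a,m} = j(q^a; q^m)`. -/
noncomputable def J (a : ℤ) (m : ℕ) (q : ℂ) : ℂ := jTheta (q ^ a) (q ^ m)

/-- `J̄_{a,m} = j(-q^a; q^m)`. -/
noncomputable def Jbar (a : ℤ) (m : ℕ) (q : ℂ) : ℂ := jTheta (-q ^ a) (q ^ m)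

/-- The `n`-th term of the third order mock theta function `φ`. -/
noncomputable def phiTerm (q : ℂ) (n : ℕ) : ℂ := q ^ (n ^ 2) / qPoch (-q ^ 2) (q ^ 2) n

/-- The third order mock theta function `φ(q) = ∑_{n ≥ 0} q^{n²} / (-q²; q²)_n`. -/
noncomputable def phi (q : ℂ) : ℂ := ∑' n : ℕ, phiTerm q n

/-- The `n`-th term of the third order mock theta function `ν`. -/
noncomputable def nuTerm (q : ℂ) (n : ℕ) : ℂ := q ^ (n * (n + 1)) / qPoch (-q) (q ^ 2) (n + 1)

/-- The third order mock theta function `ν(q) = ∑_{n ≥ 0} q^{n(n+1)} / (-q; q²)_{n+1}`. -/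
noncomputable def nu (q : ℂ) : ℂ := ∑' n : ℕ, nuTerm q n

/-- The `n`-th term of `φ̄₀`. -/
noncomputable def phibar0Term (q : ℂ) (n : ℕ) : ℂ := q ^ n * qPoch (-q) q (2 * n + 1)

/-- The Bringmann–Hikami–Lovejoy function `φ̄₀(q) = ∑_{n ≥ 0} q^n (-q; q)_{2n+1}`. -/
noncomputable def phibar0 (q : ℂ) : ℂ := ∑' n : ℕ, phibar0Term q n

/-- The `n`-th term of `φ̄₁`. -/
noncomputable def phibar1Term (q : ℂ) (n : ℕ) : ℂ := q ^ n * qPoch (-q) q (2 * n)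

/-- The Bringmann–Hikami–Lovejoy function `φ̄₁(q) = ∑_{n ≥ 0} q^n (-q; q)_{2n}`. -/
noncomputable def phibar1 (q : ℂ) : ℂ := ∑' n : ℕ, phibar1Term q n

/-- `sg(r) = 1` for `r ≥ 0` and `sg(r) = -1` for `r < 0`. -/
def sg (r : ℤ) : ℤ := if 0 ≤ r then 1 else -1

/-- The summand of `f_{a,b,c}(x, y, q)`; here `r * (r - 1) / 2` is the binomial coefficient
`r choose 2`, the division being exact. -/
noncomputable def fTerm (a b c : ℤ) (x y q : ℂ) (p : {p : ℤ × ℤ // sg p.1 = sg p.2}) : ℂ :=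
  (sg p.1.1 : ℂ) * (-1) ^ (p.1.1 + p.1.2) * x ^ p.1.1 * y ^ p.1.2 *
    q ^ (a * (p.1.1 * (p.1.1 - 1) / 2) + b * p.1.1 * p.1.2 + c * (p.1.2 * (p.1.2 - 1) / 2))

/-- The Hecke-type double sum `f_{a,b,c}(x, y, q)`, a sum over all pairs of integers `(r, s)` with
`sg(r) = sg(s)`. -/
noncomputable def f (a b c : ℤ) (x y q : ℂ) : ℂ := ∑' p, fTerm a b c x y q p

/-- `HasIndefSum t S` says that
`(∑_{n+j ≥ 0, n-j ≥ 0} - ∑_{n+j < 0, n-j < 0}) t(n, j) = S`, both sums over pairs of integers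
`(n, j)` being (absolutely) convergent. -/
def HasIndefSum (t : ℤ → ℤ → ℂ) (S : ℂ) : Prop :=
  ∃ u v : ℂ,
    HasSum (fun p : {p : ℤ × ℤ // 0 ≤ p.1 + p.2 ∧ 0 ≤ p.1 - p.2} => t p.1.1 p.1.2) u ∧
    HasSum (fun p : {p : ℤ × ℤ // p.1 + p.2 < 0 ∧ p.1 - p.2 < 0} => t p.1.1 p.1.2) v ∧
    S = u - v

/-- The inner sum `∑_{j=-n}^{n} (-1)^j q^{-3j²/2 + j/2}`; the division `j(3j-1)/2` is exact. -/
noncomputable def innerA (q : ℂ) (n : ℕ) : ℂ :=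
  ∑ j ∈ Finset.Icc (-(n : ℤ)) n, (-1) ^ j * q ^ (-(j * (3 * j - 1) / 2))

/-- The inner sum `∑_{j=-n}^{n} (-1)^j q^{-3j² - j}`. -/
noncomputable def innerB (q : ℂ) (n : ℕ) : ℂ :=
  ∑ j ∈ Finset.Icc (-(n : ℤ)) n, (-1) ^ j * q ^ (-3 * j ^ 2 - j)

end HeckeMock

/-! All four chains come from one Bailey pair relative to `a = q`, inserted into two conjugate
Bailey pairs. The kernel is 1/((q)_{n-r} (q)_{n+r+1}), and a pair means β_n = ∑_r α_r K(n, r).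

The pair: the kernel has an explicit inverse (`sum_invKernel_mul_baileyKernel`), so β = 1 forces α_r
= (1 - q^{2r+1}) times a row sum of the inverse. These row sums obey a first-order recurrence, which
q^{2r²+r} ∑_{|j|≤r} (-1)^j q^{-j(3j-1)/2} also satisfies (`heckeCoeff_eq_sum`). A contiguous
relation for the kernel turns this pair into a second one, with α_r = `heckeCoeff q r` · q^{-r}(1 -
q^{4r+2}) and β_n = q^{n+1} + [n = 0].

The conjugate pairs: the q-Gauss sum evaluates γ_r = ∑_n δ_n K(n, r) for δ_n = (A)_n (B)_n z^n with
ABz = q² (`hasSum_mul_baileyKernel`). Taking A, B = ±√q, z = -q gives δ_n = (q;q²)_n (-q)^n, and the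
infinite products collapse to 1/J̄_{1,4}. In base q², taking A = -q, B = -q², z = q gives δ_n =
(-q;q)_{2n} q^n and 1/J_{1,2}. Then ∑ α_r γ_r = ∑ δ_n β_n.

On the side of δ, Fine's transformation identifies ∑ (q;q²)_n (-q)^n with ν and 1 + q ∑ (q;q²)_n
(-q²)^n with φ. The functions φ̄₁ and qφ̄₀ + 1 are already of the required shape: the former uses
the first pair, the latter q times the first plus the second.

Finally, the reflection n ↦ -1-n folds the indefinite sums onto the cone |j| ≤ n, where summing over
j gives the single-sum forms. Splitting by the parity of n + j and putting n = r + s or r + s + 1,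
up to reflection, gives the sums f_{1,7,1}. All rearrangements rest on geometric bounds ‖term‖ ≤
‖q‖^n on the cone. -/

namespace HeckeMock

open Filter Topology

/-! ### The Bailey kernel and its inverse matrix -/

/-- The reciprocal `1 / (q; q)_k`, extended by zero to negative `k`. -/
noncomputable def recPoch (q : ℂ) (k : ℤ) : ℂ :=
  if 0 ≤ k then (qPoch q q k.toNat)⁻¹ else 0

/-- The Bailey kernel `1 / ((q; q)_{n-r} (q; q)_{n+r+1})`. -/
noncomputable def baileyKernel (q : ℂ) (n r : ℕ) : ℂ :=
  recPoch q ((n : ℤ) - r) * (qPoch q q (n + r + 1))⁻¹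

/-- The binomial coefficient `i choose 2` of an integer. -/
def tri (i : ℤ) : ℤ := i * (i - 1) / 2

/-- The entries `(-1)^{r-j} q^{(r-j choose 2)} (q; q)_{r+j} / (q; q)_{r-j}` of the matrix that
inverts the Bailey kernel. -/
noncomputable def invKernel (q : ℂ) (r j : ℕ) : ℂ :=
  (-1) ^ (r + j) * q ^ tri ((r : ℤ) - j) * qPoch q q (r + j) * recPoch q ((r : ℤ) - j)

theorem tri_add_one (i : ℤ) : tri (i + 1) = tri i + i := by
  unfold tri
  have h : (i + 1) * (i + 1 - 1) = i * (i - 1) + i * 2 := by ring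
  rw [h, Int.add_mul_ediv_right _ _ (by norm_num)]

theorem two_mul_tri (i : ℤ) : 2 * tri i = i * (i - 1) :=
  Int.mul_ediv_cancel' (even_iff_two_dvd.mp (Int.even_mul_pred_self i))

theorem qPoch_zero (x q : ℂ) : qPoch x q 0 = 1 := by simp [qPoch]

theorem qPoch_succ (x q : ℂ) (n : ℕ) : qPoch x q (n + 1) = qPoch x q n * (1 - q ^ n * x) := by
  simp [qPoch, Finset.prod_range_succ]

theorem qPoch_self_succ (q : ℂ) (n : ℕ) :
    qPoch q q (n + 1) = qPoch q q n * (1 - q ^ (n + 1)) := by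
  rw [qPoch_succ, pow_succ]

theorem qPoch_add (x q : ℂ) (m n : ℕ) :
    qPoch x q (m + n) = qPoch x q m * qPoch (q ^ m * x) q n := by
  simp only [qPoch, Finset.prod_range_add]
  congr 1
  refine Finset.prod_congr rfl fun i _ => ?_
  ring

theorem one_sub_pow_ne_zero {q : ℂ} (hq1 : ‖q‖ < 1) {n : ℕ} (hn : n ≠ 0) : 1 - q ^ n ≠ 0 := by
  intro h
  have h1 : ‖q ^ n‖ = 1 := by rw [← sub_eq_zero.mp h]; simp
  rw [norm_pow] at h1
  exact absurd h1 (pow_lt_one₀ (norm_nonneg q) hq1 hn).ne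

theorem qPoch_self_ne_zero {q : ℂ} (hq1 : ‖q‖ < 1) (n : ℕ) : qPoch q q n ≠ 0 := by
  induction n with
  | zero => simp [qPoch_zero]
  | succ n ih =>
    rw [qPoch_self_succ]
    exact mul_ne_zero ih (one_sub_pow_ne_zero hq1 n.succ_ne_zero)

theorem recPoch_natCast (q : ℂ) (k : ℕ) : recPoch q k = (qPoch q q k)⁻¹ := by
  simp [recPoch]

theorem recPoch_of_neg (q : ℂ) {k : ℤ} (hk : k < 0) : recPoch q k = 0 := by
  simp [recPoch, hk]

/-- Extending by zero to negative indices is what makes this recurrence valid for every integer: at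
k = 0 the factor 1 - q^0 vanishes. The telescopings below therefore need no case distinction, and
their boundary terms vanish by themselves. -/
theorem recPoch_sub_one {q : ℂ} (hq1 : ‖q‖ < 1) (k : ℤ) :
    recPoch q (k - 1) = (1 - q ^ k) * recPoch q k := by
  rcases lt_trichotomy k 0 with hk | rfl | hk
  · rw [recPoch_of_neg q hk, recPoch_of_neg q (by omega), mul_zero]
  · rw [recPoch_of_neg q (by omega)]; simp
  · obtain ⟨m, rfl⟩ : ∃ m : ℕ, k = (m + 1 : ℕ) := ⟨(k - 1).toNat, by omega⟩
    have : ((m + 1 : ℕ) : ℤ) - 1 = m := by push_cast; ring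
    rw [this, recPoch_natCast, recPoch_natCast, qPoch_self_succ, zpow_natCast]
    have h1 := one_sub_pow_ne_zero hq1 m.succ_ne_zero
    have h2 := qPoch_self_ne_zero hq1 m
    field_simp

theorem qPoch_inv_succ {q : ℂ} (hq1 : ‖q‖ < 1) (n : ℕ) :
    (qPoch q q n)⁻¹ = (1 - q ^ (n + 1)) * (qPoch q q (n + 1))⁻¹ := by
  rw [qPoch_self_succ]
  have h1 := one_sub_pow_ne_zero hq1 n.succ_ne_zero
  have h2 := qPoch_self_ne_zero hq1 n
  field_simp

theorem baileyKernel_of_lt (q : ℂ) {n r : ℕ} (h : n < r) : baileyKernel q n r = 0 := by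
  rw [baileyKernel, recPoch_of_neg q (by omega), zero_mul]

theorem invKernel_of_lt (q : ℂ) {r j : ℕ} (h : r < j) : invKernel q r j = 0 := by
  rw [invKernel, recPoch_of_neg q (by omega), mul_zero]

/-- After multiplication by 1 - q^{n-j}, the summand of the inversion formula is a difference G(r) -
G(r+1). G vanishes at r = 0 through its factor 1/(q)_{r-j-1} and at r = n+1 through 1/(q)_{n-r},
which proves orthogonality for j < n. -/
theorem invKernel_telescope {q : ℂ} (hq0 : q ≠ 0) (hq1 : ‖q‖ < 1) (n j r : ℕ) :
    (1 - q ^ ((n : ℤ) - j)) * ((1 - q ^ (2 * r + 1)) * invKernel q r j * baileyKernel q n r) =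
      (-1) ^ (r + j) * q ^ tri ((r : ℤ) - j) * qPoch q q (r + j) * recPoch q ((r : ℤ) - j - 1) *
        recPoch q ((n : ℤ) - r) * (qPoch q q (n + r))⁻¹ -
      (-1) ^ (r + 1 + j) * q ^ tri (((r + 1 : ℕ) : ℤ) - j) * qPoch q q (r + 1 + j) *
        recPoch q (((r + 1 : ℕ) : ℤ) - j - 1) *
        recPoch q ((n : ℤ) - (r + 1 : ℕ)) * (qPoch q q (n + (r + 1)))⁻¹ := by
  have e1 : ((r + 1 : ℕ) : ℤ) - j = ((r : ℤ) - j) + 1 := by push_cast; ring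
  have e2 : (n : ℤ) - (r + 1 : ℕ) = ((n : ℤ) - r) - 1 := by push_cast; ring
  rw [e1, e2, add_sub_cancel_right, tri_add_one, recPoch_sub_one hq1, recPoch_sub_one hq1,
    qPoch_inv_succ hq1 (n + r), ← add_assoc n r 1, show r + 1 + j = r + j + 1 by ring,
    qPoch_self_succ q (r + j), zpow_add₀ hq0]
  simp only [invKernel, baileyKernel, zpow_sub₀ hq0, zpow_natCast]
  field_simp
  ring

theorem sum_invKernel_mul_baileyKernel {q : ℂ} (hq0 : q ≠ 0) (hq1 : ‖q‖ < 1) {n j : ℕ}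
    (hj : j ≤ n) :
    ∑ r ∈ Finset.range (n + 1), (1 - q ^ (2 * r + 1)) * invKernel q r j * baileyKernel q n r =
      if j = n then 1 else 0 := by
  split_ifs with h
  · subst h
    rw [Finset.sum_range_succ, Finset.sum_eq_zero, zero_add]
    · have h1 := one_sub_pow_ne_zero hq1 (2 * j).succ_ne_zero
      have h2 := qPoch_self_ne_zero hq1 (2 * j)
      rw [invKernel, baileyKernel, sub_self, show (0 : ℤ) = (0 : ℕ) from rfl, recPoch_natCast,
        qPoch_zero, ← two_mul, pow_mul, qPoch_self_succ]
      simp only [tri]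
      field_simp
      norm_num
    · intro r hr
      rw [invKernel_of_lt q (Finset.mem_range.mp hr)]
      ring
  · have hne : 1 - q ^ ((n : ℤ) - j) ≠ 0 := by
      rw [show (n : ℤ) - j = ((n - j : ℕ) : ℤ) by omega, zpow_natCast]
      exact one_sub_pow_ne_zero hq1 (by omega)
    refine (mul_eq_zero.mp ?_).resolve_left hne
    rw [Finset.mul_sum]
    simp only [invKernel_telescope hq0 hq1]
    rw [Finset.sum_range_sub' (fun r : ℕ => (-1) ^ (r + j) * q ^ tri ((r : ℤ) - j) *
      qPoch q q (r + j) * recPoch q ((r : ℤ) - j - 1) *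
        recPoch q ((n : ℤ) - r) * (qPoch q q (n + r))⁻¹)]
    rw [recPoch_of_neg q (show ((0 : ℕ) : ℤ) - j - 1 < 0 by omega),
      recPoch_of_neg q (show (n : ℤ) - (n + 1 : ℕ) < 0 by omega)]
    ring

/-! ### Row sums of the inverse, and the two Bailey pairs -/

theorem invKernel_sub_telescope {q : ℂ} (hq0 : q ≠ 0) (hq1 : ‖q‖ < 1) (r j : ℕ) :
    invKernel q (r + 1) j - q ^ (4 * r + 3) * invKernel q r j =
      (-1) ^ (r + 1 + j) * q ^ tri ((r : ℤ) + 1 - j) * qPoch q q (r + j) *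
        recPoch q ((r : ℤ) + 1 - j) * q ^ ((r : ℤ) + 1 - j) * (1 - q ^ (2 * (r + 1))) -
      (-1) ^ (r + 1 + (j + 1)) * q ^ tri ((r : ℤ) + 1 - (j + 1 : ℕ)) * qPoch q q (r + (j + 1)) *
        recPoch q ((r : ℤ) + 1 - (j + 1 : ℕ)) * q ^ ((r : ℤ) + 1 - (j + 1 : ℕ)) *
          (1 - q ^ (2 * (r + 1))) := by
  have e1 : (r : ℤ) + 1 - (j + 1 : ℕ) = (r : ℤ) - j := by push_cast; ring
  have e2 : (r : ℤ) + 1 - j = (r : ℤ) - j + 1 := by ring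
  have e3 : recPoch q ((r : ℤ) - j) = (1 - q ^ ((r : ℤ) - j + 1)) * recPoch q ((r : ℤ) - j + 1) := by
    rw [← recPoch_sub_one hq1, add_sub_cancel_right]
  rw [invKernel, invKernel, e1, show ((r + 1 : ℕ) : ℤ) - j = (r : ℤ) - j + 1 by push_cast; ring, e2,
    e3, tri_add_one, show r + 1 + j = r + j + 1 by ring, ← add_assoc r j 1, qPoch_self_succ]
  simp only [zpow_add₀ hq0, zpow_sub₀ hq0, zpow_natCast, zpow_one]
  field_simp
  ring

/-- The difference of consecutive rows, with weight q^{4r+3}, telescopes in j, and only the boundary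
term at j = 0 survives. The weight is the ratio of the prefactors q^{2r²+r} at r+1 and r, so the
recurrence matches the growth of the Hecke sum by its two terms j = ±(r+1). -/
theorem sum_invKernel_succ {q : ℂ} (hq0 : q ≠ 0) (hq1 : ‖q‖ < 1) (r : ℕ) :
    ∑ j ∈ Finset.range (r + 2), invKernel q (r + 1) j =
      q ^ (4 * r + 3) * ∑ j ∈ Finset.range (r + 1), invKernel q r j +
        (-1) ^ (r + 1) * q ^ tri (r + 2) * (1 + q ^ (r + 1)) := by
  have h : ∑ j ∈ Finset.range (r + 2), (invKernel q (r + 1) j - q ^ (4 * r + 3) * invKernel q r j) =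
      (-1) ^ (r + 1) * q ^ tri (r + 2) * (1 + q ^ (r + 1)) := by
    simp only [invKernel_sub_telescope hq0 hq1]
    rw [Finset.sum_range_sub' (fun j : ℕ => (-1) ^ (r + 1 + j) * q ^ tri ((r : ℤ) + 1 - j) *
      qPoch q q (r + j) * recPoch q ((r : ℤ) + 1 - j) * q ^ ((r : ℤ) + 1 - j) *
        (1 - q ^ (2 * (r + 1))))]
    rw [recPoch_of_neg q (show (r : ℤ) + 1 - (r + 2 : ℕ) < 0 by push_cast; omega)]
    have e : (r : ℤ) + 1 - (0 : ℕ) = (r + 1 : ℕ) := by push_cast; ring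
    have e2 : (r : ℤ) + 2 = (r + 1 : ℕ) + 1 := by push_cast; ring
    rw [e, e2, tri_add_one, recPoch_natCast, zpow_add₀ hq0, zpow_natCast, add_zero, add_zero,
      qPoch_self_succ]
    have h1 := one_sub_pow_ne_zero hq1 r.succ_ne_zero
    have h2 := qPoch_self_ne_zero hq1 r
    field_simp
    ring
  rw [Finset.sum_sub_distrib, ← Finset.mul_sum, Finset.sum_range_succ (fun j => invKernel q r j),
    invKernel_of_lt q (Nat.lt_succ_self r), add_zero] at h
  linear_combination h

theorem innerA_succ (q : ℂ) (n : ℕ) :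
    innerA q (n + 1) = innerA q n +
      (-1) ^ (n + 1) * (q ^ (-tri (n + 2) - 2 * tri (n + 1)) +
        q ^ (-tri (n + 2) - 2 * tri (n + 1) - (n + 1))) := by
  have hs : Finset.Icc (-((n + 1 : ℕ) : ℤ)) ((n + 1 : ℕ) : ℤ) =
      insert (-((n + 1 : ℕ) : ℤ)) (insert ((n + 1 : ℕ) : ℤ) (Finset.Icc (-(n : ℤ)) n)) := by
    ext x; simp only [Finset.mem_Icc, Finset.mem_insert]; push_cast; omega
  have d1 := two_mul_tri ((n : ℤ) + 2)
  have d2 := two_mul_tri ((n : ℤ) + 1)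
  have p1 : ((n + 1 : ℕ) : ℤ) * (3 * ((n + 1 : ℕ) : ℤ) - 1) / 2 = tri (n + 2) + 2 * tri (n + 1) := by
    apply Int.ediv_eq_of_eq_mul_right (by norm_num); push_cast; linear_combination -d1 - 2 * d2
  have p2 : -((n + 1 : ℕ) : ℤ) * (3 * -((n + 1 : ℕ) : ℤ) - 1) / 2 =
      tri (n + 2) + 2 * tri (n + 1) + (n + 1) := by
    apply Int.ediv_eq_of_eq_mul_right (by norm_num); push_cast; linear_combination -d1 - 2 * d2
  rw [innerA, hs, Finset.sum_insert, Finset.sum_insert, p1, p2, ← innerA]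
  · have hs : ((-1 : ℂ)) ^ (-((n + 1 : ℕ) : ℤ)) = (-1) ^ (n + 1) := by
      rw [zpow_neg, zpow_natCast, ← inv_pow, inv_neg_one]
    rw [hs, zpow_natCast, neg_add (tri _ + _), neg_add (tri _), ← sub_eq_add_neg, ← sub_eq_add_neg]
    ring
  · simp
  · simp only [Finset.mem_insert, Finset.mem_Icc]; push_cast; omega

/-- The sequence `q^{2r² + r} ∑_{|j| ≤ r} (-1)^j q^{-j(3j-1)/2}`. -/
noncomputable def heckeCoeff (q : ℂ) (r : ℕ) : ℂ := q ^ (2 * r ^ 2 + r) * innerA q r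

theorem heckeCoeff_eq_sum {q : ℂ} (hq0 : q ≠ 0) (hq1 : ‖q‖ < 1) (r : ℕ) :
    heckeCoeff q r = ∑ j ∈ Finset.range (r + 1), invKernel q r j := by
  induction r with
  | zero => simp [heckeCoeff, innerA, invKernel, tri, recPoch, qPoch]
  | succ r ih =>
    rw [sum_invKernel_succ hq0 hq1, ← ih, heckeCoeff, heckeCoeff, innerA_succ]
    have d1 := two_mul_tri ((r : ℤ) + 2)
    have d2 := two_mul_tri ((r : ℤ) + 1)
    have h1 : q ^ (2 * (r + 1) ^ 2 + (r + 1)) * q ^ (-tri (r + 2) - 2 * tri (r + 1)) =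
        q ^ tri (r + 2) * q ^ (r + 1) := by
      simp only [← zpow_natCast, ← zpow_add₀ hq0]
      congr 1; push_cast; linear_combination -d1 - d2
    have h2 : q ^ (2 * (r + 1) ^ 2 + (r + 1)) * q ^ (-tri (r + 2) - 2 * tri (r + 1) - (r + 1)) =
        q ^ tri (r + 2) := by
      simp only [← zpow_natCast, ← zpow_add₀ hq0]
      congr 1; push_cast; linear_combination -d1 - d2
    linear_combination (-1) ^ (r + 1) * (h1 + h2)

theorem sum_heckeCoeff_mul_baileyKernel {q : ℂ} (hq0 : q ≠ 0) (hq1 : ‖q‖ < 1) (n : ℕ) :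
    ∑ r ∈ Finset.range (n + 1), heckeCoeff q r * (1 - q ^ (2 * r + 1)) * baileyKernel q n r = 1 := by
  have h : ∀ r ∈ Finset.range (n + 1),
      heckeCoeff q r * (1 - q ^ (2 * r + 1)) * baileyKernel q n r =
      ∑ j ∈ Finset.range (n + 1), (1 - q ^ (2 * r + 1)) * invKernel q r j * baileyKernel q n r := by
    intro r hr
    rw [heckeCoeff_eq_sum hq0 hq1, Finset.sum_subset
      (Finset.range_mono (Nat.succ_le_of_lt (Finset.mem_range.mp hr)))
      (fun j _ hj => invKernel_of_lt q (by simpa using hj)), Finset.sum_mul, Finset.sum_mul]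
    exact Finset.sum_congr rfl fun j _ => by ring
  rw [Finset.sum_congr rfl h, Finset.sum_comm,
    Finset.sum_congr rfl fun j hj => sum_invKernel_mul_baileyKernel hq0 hq1
      (Nat.lt_succ_iff.mp (Finset.mem_range.mp hj))]
  simp

/-- Since K(n-1, r) = (1 - q^{n-r})(1 - q^{n+r+1}) K(n, r), one has q^n (q^{-r} + q^{r+1}) K(n, r) =
(1 + q^{2n+1}) K(n, r) - K(n-1, r). Summing against the first pair leaves q^{2n+1} for n ≥ 1. For n
= 0 there is no previous row to subtract, whence the extra 1. -/
theorem sum_heckeCoeff_mul_baileyKernel' {q : ℂ} (hq0 : q ≠ 0) (hq1 : ‖q‖ < 1) (n : ℕ) :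
    ∑ r ∈ Finset.range (n + 1),
      heckeCoeff q r * (q ^ r)⁻¹ * (1 - q ^ (4 * r + 2)) * baileyKernel q n r =
      q ^ (n + 1) + if n = 0 then 1 else 0 := by
  rcases n with _ | n
  · have h : 1 - q ≠ 0 := by simpa using one_sub_pow_ne_zero hq1 one_ne_zero
    simp only [heckeCoeff, innerA, baileyKernel, recPoch, qPoch]
    simp
    field_simp
    ring
  · have h0 := sum_heckeCoeff_mul_baileyKernel hq0 hq1 n
    have h1 := sum_heckeCoeff_mul_baileyKernel hq0 hq1 (n + 1)
    have e : ∑ r ∈ Finset.range (n + 2),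
        heckeCoeff q r * (1 - q ^ (2 * r + 1)) * baileyKernel q n r = 1 := by
      rw [Finset.sum_range_succ, h0, baileyKernel_of_lt q (Nat.lt_succ_self n), mul_zero, add_zero]
    have key : ∀ r, q ^ (n + 1) *
        (heckeCoeff q r * (q ^ r)⁻¹ * (1 - q ^ (4 * r + 2)) * baileyKernel q (n + 1) r) =
        (1 + q ^ (2 * n + 3)) *
          (heckeCoeff q r * (1 - q ^ (2 * r + 1)) * baileyKernel q (n + 1) r) -
        heckeCoeff q r * (1 - q ^ (2 * r + 1)) * baileyKernel q n r := by
      intro r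
      rw [baileyKernel, baileyKernel, show (n : ℤ) - r = ((n + 1 : ℕ) : ℤ) - r - 1 by push_cast; ring,
        recPoch_sub_one hq1, qPoch_inv_succ hq1 (n + r + 1), show n + 1 + r + 1 = n + r + 1 + 1 by ring]
      simp only [zpow_sub₀ hq0, zpow_natCast]
      field_simp
      ring
    have h2 := Finset.sum_congr (rfl : Finset.range (n + 2) = _) fun r _ => key r
    rw [← Finset.mul_sum, Finset.sum_sub_distrib, ← Finset.mul_sum, h1, e] at h2
    have h3 : q ^ (n + 1) ≠ 0 := pow_ne_zero _ hq0
    apply mul_left_cancel₀ h3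
    rw [h2]
    simp
    ring

/-! ### Infinite products: limits, bounds and splitting -/

theorem tendsto_qPoch (x : ℂ) {q : ℂ} (hq1 : ‖q‖ < 1) :
    Tendsto (qPoch x q) atTop (𝓝 (qPochInf x q)) :=
  (multipliable_qPochInf x q hq1).hasProd.tendsto_prod_nat

theorem qPochInf_ne_zero {x q : ℂ} (hq1 : ‖q‖ < 1) (hx : ∀ i : ℕ, 1 - q ^ i * x ≠ 0) :
    qPochInf x q ≠ 0 := by
  have h : Summable (fun i : ℕ => ‖-(q ^ i * x)‖) := by
    simpa [norm_mul, norm_pow] using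
      (summable_geometric_of_lt_one (norm_nonneg q) hq1).mul_right ‖x‖
  simpa only [qPochInf, sub_eq_add_neg] using
    tprod_one_add_ne_zero_of_summable (f := fun i : ℕ => -(q ^ i * x))
      (by simpa only [sub_eq_add_neg] using hx) h

theorem one_sub_pow_mul_ne_zero {x q : ℂ} (hq1 : ‖q‖ < 1) (hx : ‖x‖ < 1) (i : ℕ) :
    1 - q ^ i * x ≠ 0 := by
  intro h
  have h1 : ‖q ^ i * x‖ = 1 := by rw [← sub_eq_zero.mp h]; simp
  have h2 : ‖q ^ i * x‖ < 1 := by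
    rw [norm_mul, norm_pow]
    exact (mul_le_of_le_one_left (norm_nonneg x) (pow_le_one₀ (norm_nonneg q) hq1.le)).trans_lt hx
  exact absurd h1 h2.ne

theorem qPoch_ne_zero {x q : ℂ} (hx : ∀ i : ℕ, 1 - q ^ i * x ≠ 0) (n : ℕ) : qPoch x q n ≠ 0 :=
  Finset.prod_ne_zero_iff.mpr fun i _ => hx i

theorem exists_norm_qPoch_le (x : ℂ) {q : ℂ} (hq1 : ‖q‖ < 1) :
    ∃ C, 0 < C ∧ ∀ n, ‖qPoch x q n‖ ≤ C := by
  obtain ⟨C, hC, h⟩ :=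
    (Metric.isBounded_range_of_tendsto _ (tendsto_qPoch x hq1)).exists_pos_norm_le
  exact ⟨C, hC, fun n => h _ ⟨n, rfl⟩⟩

theorem exists_norm_qPoch_inv_le {x q : ℂ} (hq1 : ‖q‖ < 1) (hx : ∀ i : ℕ, 1 - q ^ i * x ≠ 0) :
    ∃ C, 0 < C ∧ ∀ n, ‖(qPoch x q n)⁻¹‖ ≤ C := by
  obtain ⟨C, hC, h⟩ := (Metric.isBounded_range_of_tendsto _
    ((tendsto_qPoch x hq1).inv₀ (qPochInf_ne_zero hq1 hx))).exists_pos_norm_le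
  exact ⟨C, hC, fun n => h _ ⟨n, rfl⟩⟩

theorem qPochInf_eq_mul (x : ℂ) {q : ℂ} (hq1 : ‖q‖ < 1) (n : ℕ) :
    qPochInf x q = qPoch x q n * qPochInf (q ^ n * x) q := by
  have h1 : Tendsto (fun m => qPoch x q (n + m)) atTop (𝓝 (qPochInf x q)) := by
    simpa only [add_comm n] using (tendsto_add_atTop_iff_nat n).mpr (tendsto_qPoch x hq1)
  have h2 := (tendsto_qPoch (q ^ n * x) hq1).const_mul (qPoch x q n)
  simp only [← qPoch_add] at h2
  exact tendsto_nhds_unique h1 h2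

theorem norm_sq_lt_one {q : ℂ} (hq1 : ‖q‖ < 1) : ‖q ^ 2‖ < 1 := by
  rw [norm_pow]; exact pow_lt_one₀ (norm_nonneg q) hq1 two_ne_zero

theorem qPoch_two_mul (x q : ℂ) (n : ℕ) :
    qPoch x q (2 * n) = qPoch x (q ^ 2) n * qPoch (q * x) (q ^ 2) n := by
  induction n with
  | zero => simp [qPoch]
  | succ n ih =>
    rw [show 2 * (n + 1) = 2 * n + 1 + 1 by ring, qPoch_succ, qPoch_succ, ih, qPoch_succ, qPoch_succ]
    ring

theorem qPochInf_eq_mul_sq (x : ℂ) {q : ℂ} (hq1 : ‖q‖ < 1) :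
    qPochInf x q = qPochInf x (q ^ 2) * qPochInf (q * x) (q ^ 2) := by
  have h1 : Tendsto (fun m => qPoch x q (2 * m)) atTop (𝓝 (qPochInf x q)) :=
    (tendsto_qPoch x hq1).comp (tendsto_id.const_mul_atTop' two_pos)
  have h2 := (tendsto_qPoch x (norm_sq_lt_one hq1)).mul
    (tendsto_qPoch (q * x) (norm_sq_lt_one hq1))
  simp only [← qPoch_two_mul] at h2
  exact tendsto_nhds_unique h1 h2

theorem qPoch_mul_neg (x q : ℂ) (n : ℕ) :
    qPoch x q n * qPoch (-x) q n = qPoch (x ^ 2) (q ^ 2) n := by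
  simp only [qPoch, ← Finset.prod_mul_distrib]
  exact Finset.prod_congr rfl fun i _ => by ring

theorem qPochInf_mul_neg (x : ℂ) {q : ℂ} (hq1 : ‖q‖ < 1) :
    qPochInf x q * qPochInf (-x) q = qPochInf (x ^ 2) (q ^ 2) := by
  have h1 := (tendsto_qPoch x hq1).mul (tendsto_qPoch (-x) hq1)
  simp only [qPoch_mul_neg] at h1
  exact tendsto_nhds_unique h1 (tendsto_qPoch _ (norm_sq_lt_one hq1))

/-! ### The q-Gauss summation -/

/-- The `n`-th term of the basic hypergeometric series `₂φ₁(a, b; abz; q, z)`. -/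
noncomputable def gaussTerm (a b q z : ℂ) (n : ℕ) : ℂ :=
  qPoch a q n * qPoch b q n * z ^ n * (qPoch q q n)⁻¹ * (qPoch (a * b * z) q n)⁻¹

section Gauss

variable {a b q z : ℂ}

theorem exists_norm_gaussTerm_le (hq1 : ‖q‖ < 1)
    (hc : ∀ i : ℕ, 1 - q ^ i * (a * b * z) ≠ 0) :
    ∃ C, 0 < C ∧ ∀ N n, ‖gaussTerm a b q (q ^ N * z) n‖ ≤ C * (‖q‖ ^ N * ‖z‖) ^ n := by
  obtain ⟨A, hA, hA'⟩ := exists_norm_qPoch_le a hq1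
  obtain ⟨B, hB, hB'⟩ := exists_norm_qPoch_le b hq1
  obtain ⟨D, hD, hD'⟩ := exists_norm_qPoch_le (a * b * z) hq1
  obtain ⟨E, hE, hE'⟩ := exists_norm_qPoch_inv_le hq1 hc
  obtain ⟨F, hF, hF'⟩ := exists_norm_qPoch_inv_le hq1 (one_sub_pow_mul_ne_zero hq1 hq1)
  refine ⟨A * B * F * (D * E), by positivity, fun N n => ?_⟩
  -- The lower parameter abz moves with z. Rewriting its factor as a quotient of products with fixed
  -- base point abz makes the bound uniform in N.
  have h : (qPoch (a * b * (q ^ N * z)) q n)⁻¹ =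
      qPoch (a * b * z) q N * (qPoch (a * b * z) q (N + n))⁻¹ := by
    rw [qPoch_add, show a * b * (q ^ N * z) = q ^ N * (a * b * z) by ring, mul_inv,
      mul_inv_cancel_left₀ (qPoch_ne_zero hc N)]
  rw [gaussTerm, h]
  simp only [norm_mul, norm_pow]
  calc _ ≤ A * B * (‖q‖ ^ N * ‖z‖) ^ n * F * (D * E) := by
        gcongr
        exacts [hA' n, hB' n, hF' n, hD' N, hE' _]
    _ = _ := by ring

theorem summable_gaussTerm (hq1 : ‖q‖ < 1) (hz : ‖z‖ < 1)
    (hc : ∀ i : ℕ, 1 - q ^ i * (a * b * z) ≠ 0) : Summable (gaussTerm a b q z) := by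
  obtain ⟨C, -, hC⟩ := exists_norm_gaussTerm_le hq1 hc
  refine Summable.of_norm_bounded
    ((summable_geometric_of_lt_one (norm_nonneg z) hz).mul_left C) fun n => ?_
  simpa using hC 0 n

/-- Termwise form of the functional equation (1-z)(1-abz) F(z) = (1-az)(1-bz) F(qz). Iterating that
equation, with F(q^N z) → 1, yields the product formula. -/
theorem gaussTerm_telescope (hq1 : ‖q‖ < 1) (hc : ∀ i : ℕ, 1 - q ^ i * (a * b * z) ≠ 0) (n : ℕ) :
    (1 - z) * (1 - a * b * z) * gaussTerm a b q z n -
        (1 - a * z) * (1 - b * z) * gaussTerm a b q (q * z) n =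
      (1 - a * b * z) * (1 - q ^ n) * gaussTerm a b q z n -
        (1 - a * b * z) * (1 - q ^ (n + 1)) * gaussTerm a b q z (n + 1) := by
  have h0 : 1 - a * b * z ≠ 0 := by simpa using hc 0
  have hn := hc n
  have h : (qPoch (a * b * (q * z)) q n)⁻¹ =
      (1 - a * b * z) * (qPoch (a * b * z) q (n + 1))⁻¹ := by
    rw [add_comm n 1, qPoch_add, show a * b * (q * z) = q ^ 1 * (a * b * z) by ring, mul_inv]
    simp [qPoch, h0]
  have h2 : (qPoch (a * b * z) q n)⁻¹ =
      (1 - q ^ n * (a * b * z)) * (qPoch (a * b * z) q (n + 1))⁻¹ := by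
    rw [qPoch_succ, mul_inv, mul_left_comm, mul_inv_cancel₀ hn, mul_one]
  simp only [gaussTerm, h, h2, qPoch_inv_succ hq1 n, qPoch_succ a, qPoch_succ b]
  ring

theorem tsum_gaussTerm_step (hq1 : ‖q‖ < 1) (hz : ‖z‖ < 1)
    (hc : ∀ i : ℕ, 1 - q ^ i * (a * b * z) ≠ 0) :
    (1 - z) * (1 - a * b * z) * ∑' n, gaussTerm a b q z n =
      (1 - a * z) * (1 - b * z) * ∑' n, gaussTerm a b q (q * z) n := by
  have hs := summable_gaussTerm hq1 hz hc
  have hs' : Summable (gaussTerm a b q (q * z)) := by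
    refine summable_gaussTerm hq1 ?_ fun i => ?_
    · rw [norm_mul]
      exact (mul_le_of_le_one_left (norm_nonneg z) hq1.le).trans_lt hz
    · have := hc (i + 1)
      rwa [show q ^ (i + 1) * (a * b * z) = q ^ i * (a * b * (q * z)) by ring] at this
  have h1 : HasSum (fun n => (1 - z) * (1 - a * b * z) * gaussTerm a b q z n -
      (1 - a * z) * (1 - b * z) * gaussTerm a b q (q * z) n)
      ((1 - z) * (1 - a * b * z) * ∑' n, gaussTerm a b q z n -
        (1 - a * z) * (1 - b * z) * ∑' n, gaussTerm a b q (q * z) n) :=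
    (hs.hasSum.mul_left _).sub (hs'.hasSum.mul_left _)
  have h2 := h1.tendsto_sum_nat
  simp only [gaussTerm_telescope hq1 hc] at h2
  have h3 : ∀ N, ∑ n ∈ Finset.range N, ((1 - a * b * z) * (1 - q ^ n) * gaussTerm a b q z n -
        (1 - a * b * z) * (1 - q ^ (n + 1)) * gaussTerm a b q z (n + 1)) =
      -((1 - a * b * z) * (1 - q ^ N) * gaussTerm a b q z N) := by
    intro N
    rw [Finset.sum_range_sub' (fun n => (1 - a * b * z) * (1 - q ^ n) * gaussTerm a b q z n)]
    simp
  simp only [h3] at h2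
  have h4 : Tendsto (fun N => -((1 - a * b * z) * (1 - q ^ N) * gaussTerm a b q z N)) atTop
      (𝓝 (-((1 - a * b * z) * (1 - 0) * 0))) :=
    (((tendsto_pow_atTop_nhds_zero_of_norm_lt_one hq1).const_sub 1).const_mul _ |>.mul
      hs.tendsto_atTop_zero).neg
  have h5 := tendsto_nhds_unique h2 h4
  linear_combination h5

theorem tsum_gaussTerm_iterate (hq1 : ‖q‖ < 1) (hz : ‖z‖ < 1)
    (hc : ∀ i : ℕ, 1 - q ^ i * (a * b * z) ≠ 0) (N : ℕ) :
    qPoch z q N * qPoch (a * b * z) q N * ∑' n, gaussTerm a b q z n =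
      qPoch (a * z) q N * qPoch (b * z) q N * ∑' n, gaussTerm a b q (q ^ N * z) n := by
  induction N with
  | zero => simp [qPoch]
  | succ N ih =>
    have h := tsum_gaussTerm_step (a := a) (b := b) (z := q ^ N * z) hq1
      (by rw [norm_mul, norm_pow]
          exact (mul_le_of_le_one_left (norm_nonneg z)
            (pow_le_one₀ (norm_nonneg q) hq1.le)).trans_lt hz)
      (fun i => by
        rw [show q ^ i * (a * b * (q ^ N * z)) = q ^ (i + N) * (a * b * z) by ring]; exact hc _)
    rw [← mul_assoc q, ← pow_succ'] at h
    simp only [qPoch_succ]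
    linear_combination (1 - q ^ N * z) * (1 - q ^ N * (a * b * z)) * ih +
      qPoch (a * z) q N * qPoch (b * z) q N * h

theorem tendsto_tsum_gaussTerm (hq1 : ‖q‖ < 1) (hz : ‖z‖ < 1)
    (hc : ∀ i : ℕ, 1 - q ^ i * (a * b * z) ≠ 0) :
    Tendsto (fun N => ∑' n, gaussTerm a b q (q ^ N * z) n) atTop (𝓝 1) := by
  obtain ⟨C, hC0, hC⟩ := exists_norm_gaussTerm_le hq1 hc
  have h1 : ∑' n : ℕ, (if n = 0 then (1 : ℂ) else 0) = 1 := by simp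
  rw [← h1]
  refine tendsto_tsum_of_dominated_convergence (bound := fun n => C * ‖z‖ ^ n)
    ((summable_geometric_of_lt_one (norm_nonneg z) hz).mul_left C) (fun n => ?_)
    (Eventually.of_forall fun N n => ?_)
  · rcases n with _ | n
    · simp [gaussTerm, qPoch]
    · simp only [Nat.succ_ne_zero, if_false]
      refine squeeze_zero_norm (a := fun N => C * (‖q‖ ^ N * ‖z‖) ^ (n + 1)) (fun N => hC N _) ?_
      have := (((tendsto_pow_atTop_nhds_zero_of_lt_one (norm_nonneg q) hq1).mul_const ‖z‖).pow
        (n + 1)).const_mul C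
      simpa using this
  · refine (hC N n).trans ?_
    gcongr
    exact mul_le_of_le_one_left (norm_nonneg z) (pow_le_one₀ (norm_nonneg q) hq1.le)

/-- The `q`-Gauss summation. -/
theorem hasSum_gaussTerm (hq1 : ‖q‖ < 1) (hz : ‖z‖ < 1)
    (hc : ∀ i : ℕ, 1 - q ^ i * (a * b * z) ≠ 0) :
    HasSum (gaussTerm a b q z)
      (qPochInf (a * z) q * qPochInf (b * z) q / (qPochInf (a * b * z) q * qPochInf z q)) := by
  have h1 := (((tendsto_qPoch z hq1).mul (tendsto_qPoch (a * b * z) hq1)).mul_const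
    (∑' n, gaussTerm a b q z n))
  have h2 := ((tendsto_qPoch (a * z) hq1).mul (tendsto_qPoch (b * z) hq1)).mul
    (tendsto_tsum_gaussTerm hq1 hz hc)
  simp only [tsum_gaussTerm_iterate hq1 hz hc] at h1
  have h3 := tendsto_nhds_unique h1 h2
  have h4 := qPochInf_ne_zero hq1 hc
  have h5 := qPochInf_ne_zero hq1 (one_sub_pow_mul_ne_zero hq1 hz)
  have h6 : ∑' n, gaussTerm a b q z n =
      qPochInf (a * z) q * qPochInf (b * z) q / (qPochInf (a * b * z) q * qPochInf z q) := by
    rw [eq_div_iff (mul_ne_zero h4 h5)]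
    linear_combination h3
  exact h6 ▸ (summable_gaussTerm hq1 hz hc).hasSum

end Gauss

/-! ### Conjugate Bailey pairs and the Bailey transform -/

/-- The `q`-Gauss summation against the Bailey kernel. -/
theorem hasSum_mul_baileyKernel {A B q z : ℂ} (hq1 : ‖q‖ < 1) (hz : ‖z‖ < 1)
    (h : A * B * z = q ^ 2) (r : ℕ) :
    HasSum (fun n => qPoch A q n * qPoch B q n * z ^ n * baileyKernel q n r)
      (qPoch A q r * qPoch B q r * z ^ r * qPochInf (q ^ r * (A * z)) q *
        qPochInf (q ^ r * (B * z)) q / (qPochInf q q * qPochInf z q)) := by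
  have hc : ∀ i : ℕ, 1 - q ^ i * (q ^ r * A * (q ^ r * B) * z) ≠ 0 := fun i => by
    rw [show q ^ i * (q ^ r * A * (q ^ r * B) * z) = q ^ (i + 2 * r + 2) by
      linear_combination q ^ i * q ^ r * q ^ r * h]
    exact one_sub_pow_ne_zero hq1 (by omega)
  have hg := (hasSum_gaussTerm hq1 hz hc).mul_left
    (qPoch A q r * qPoch B q r * z ^ r * (qPoch q q (2 * r + 1))⁻¹)
  -- The kernel vanishes for n < r. With n = r + m, the rest is a q-Gauss series with parameters q^r
  -- A, q^r B and lower parameter q^{2r+2}, which equals (q^r A)(q^r B)z because ABz = q².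
  rw [← hasSum_nat_add_iff' r, Finset.sum_eq_zero, sub_zero]
  · have e : q ^ r * A * (q ^ r * B) * z = q ^ (2 * r + 1) * q := by
      linear_combination q ^ r * q ^ r * h
    have ef : (fun m => qPoch A q (m + r) * qPoch B q (m + r) * z ^ (m + r) *
        baileyKernel q (m + r) r) = fun m => qPoch A q r * qPoch B q r * z ^ r *
          (qPoch q q (2 * r + 1))⁻¹ * gaussTerm (q ^ r * A) (q ^ r * B) q z m := by
      ext m
      rw [gaussTerm, baileyKernel, e, show m + r + r + 1 = 2 * r + 1 + m by ring, add_comm m r,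
        show ((r + m : ℕ) : ℤ) - r = m by push_cast; ring, recPoch_natCast, qPoch_add, qPoch_add,
        qPoch_add q q (2 * r + 1), mul_inv]
      ring
    rw [ef, qPochInf_eq_mul q hq1 (2 * r + 1)]
    rw [e, mul_assoc (q ^ r) A z, mul_assoc (q ^ r) B z] at hg
    refine Eq.subst (motive := fun s => HasSum _ s) ?_ hg
    rw [div_eq_mul_inv, div_eq_mul_inv, mul_inv, mul_inv, mul_inv]
    ring
  · intro n hn
    rw [baileyKernel_of_lt q (Finset.mem_range.mp hn), mul_zero]

theorem exists_norm_baileyKernel_le {q : ℂ} (hq1 : ‖q‖ < 1) :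
    ∃ C, 0 < C ∧ ∀ n r, ‖baileyKernel q n r‖ ≤ C := by
  obtain ⟨C, hC, h⟩ := exists_norm_qPoch_inv_le hq1 (one_sub_pow_mul_ne_zero hq1 hq1)
  refine ⟨C * C, by positivity, fun n r => ?_⟩
  rw [baileyKernel, norm_mul]
  refine mul_le_mul ?_ (h _) (norm_nonneg _) hC.le
  rw [recPoch]
  split_ifs
  · exact h _
  · simpa using hC.le

/-- The Bailey transform: interchange of summation in `∑ δ_n β_n` for a Bailey pair. -/
theorem hasSum_bailey_transform {q : ℂ} (hq1 : ‖q‖ < 1) {δ α β γ : ℕ → ℂ}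
    (hδ : Summable fun n => ‖δ n‖) (hα : Summable fun r => ‖α r‖)
    (hβ : ∀ n, ∑ r ∈ Finset.range (n + 1), α r * baileyKernel q n r = β n)
    (hγ : ∀ r, HasSum (fun n => δ n * baileyKernel q n r) (γ r)) :
    HasSum (fun r => α r * γ r) (∑' n, δ n * β n) ∧ Summable fun n => δ n * β n := by
  obtain ⟨C, hC, hK⟩ := exists_norm_baileyKernel_le hq1
  -- The kernel is bounded, so absolute summability of δ and α alone makes the double series
  -- absolutely convergent.
  have hF : Summable fun p : ℕ × ℕ => δ p.1 * (α p.2 * baileyKernel q p.1 p.2) := by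
    refine Summable.of_norm_bounded
      ((hδ.mul_of_nonneg hα (fun _ => norm_nonneg _) (fun _ => norm_nonneg _)).mul_right C)
      fun p => ?_
    rw [norm_mul, norm_mul, mul_assoc]
    gcongr
    exact hK _ _
  have h1 : HasSum (fun n => δ n * β n) (∑' p : ℕ × ℕ, δ p.1 * (α p.2 * baileyKernel q p.1 p.2)) := by
    refine hF.hasSum.prod_fiberwise fun n => HasSum.mul_left _ ?_
    rw [← hβ]
    refine hasSum_sum_of_ne_finset_zero fun r hr => ?_
    rw [baileyKernel_of_lt q (by simpa using hr), mul_zero]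
  have h2 : HasSum (fun r => α r * γ r)
      (∑' p : ℕ × ℕ, δ p.1 * (α p.2 * baileyKernel q p.1 p.2)) := by
    refine HasSum.prod_fiberwise ((Equiv.prodComm ℕ ℕ).hasSum_iff.mpr hF.hasSum) fun r => ?_
    simpa only [Function.comp_apply, Equiv.prodComm_apply, Prod.swap, mul_left_comm] using
      (hγ r).mul_left (α r)
  exact ⟨h1.tsum_eq ▸ h2, h1.summable⟩

theorem summable_norm_qPoch_mul_pow (A B : ℂ) {q z : ℂ} (hq1 : ‖q‖ < 1) (hz : ‖z‖ < 1) :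
    Summable fun n => ‖qPoch A q n * qPoch B q n * z ^ n‖ := by
  obtain ⟨C, hC, h⟩ := exists_norm_qPoch_le A hq1
  obtain ⟨D, hD, h'⟩ := exists_norm_qPoch_le B hq1
  refine Summable.of_nonneg_of_le (fun _ => norm_nonneg _) (fun n => ?_)
    ((summable_geometric_of_lt_one (norm_nonneg z) hz).mul_left (C * D))
  rw [norm_mul, norm_mul, norm_pow]
  gcongr
  exacts [h n, h' n]

theorem one_add_pow_ne_zero {q : ℂ} (hq1 : ‖q‖ < 1) {n : ℕ} (hn : n ≠ 0) : 1 + q ^ n ≠ 0 := by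
  have h := one_sub_pow_ne_zero (norm_sq_lt_one hq1) hn
  rw [← pow_mul, mul_comm 2, pow_mul] at h
  exact fun h1 => h (by linear_combination (1 - q ^ n) * h1)

/-! ### The two specializations of the conjugate pair -/

theorem qPochInf_self_mul_neg {q : ℂ} (hq1 : ‖q‖ < 1) :
    qPochInf (-q) q * qPochInf q (q ^ 2) = 1 := by
  have h1 := qPochInf_mul_neg q hq1
  have h2 := qPochInf_eq_mul_sq q hq1
  have h3 := qPochInf_ne_zero (norm_sq_lt_one hq1)
    (one_sub_pow_mul_ne_zero (norm_sq_lt_one hq1) (norm_sq_lt_one hq1))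
  rw [← pow_two] at h2
  apply mul_right_cancel₀ h3
  rw [h2] at h1
  linear_combination h1

/-- Merging residues mod 4 gives J̄_{1,4} = (-q;q²)_∞ (q⁴;q⁴)_∞ = (-q;q)_∞ (q²;q²)_∞. The factor
(q;q²)_∞ then completes (q;q)_∞. -/
theorem Jbar_mul_qPochInf {q : ℂ} (hq0 : q ≠ 0) (hq1 : ‖q‖ < 1) :
    Jbar 1 4 q * qPochInf q (q ^ 2) = qPochInf q q * qPochInf (-q) q := by
  have hQ := norm_sq_lt_one hq1
  have h1 := qPochInf_eq_mul_sq (-q) hQ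
  have h2 := qPochInf_mul_neg (q ^ 2) hQ
  have h3 := qPochInf_eq_mul_sq (-q) hq1
  have h4 := qPochInf_eq_mul_sq q hq1
  have e1 : q ^ 4 / -q = q ^ 2 * -q := by field_simp
  have e2 : (q ^ 2) ^ 2 = q ^ 4 := by ring
  have e3 : q * -q = -q ^ 2 := by ring
  rw [e2] at h1 h2
  rw [e3] at h3
  rw [← pow_two] at h4
  rw [Jbar, jTheta, zpow_one, e1, ← h1, ← h2, h3, h4]
  ring

theorem J_eq {q : ℂ} (hq0 : q ≠ 0) :
    J 1 2 q = qPochInf q (q ^ 2) ^ 2 * qPochInf (q ^ 2) (q ^ 2) := by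
  have e1 : q ^ 2 / q = q := by field_simp
  rw [J, jTheta, zpow_one, e1, pow_two (qPochInf q (q ^ 2))]

/-- The Bailey transform with `δ_n = (q; q²)_n (-q)^n`. -/
theorem hasSum_bailey_neg {q : ℂ} (hq0 : q ≠ 0) (hq1 : ‖q‖ < 1) {α β : ℕ → ℂ}
    (hα : Summable fun r => ‖α r‖)
    (hβ : ∀ n, ∑ r ∈ Finset.range (n + 1), α r * baileyKernel q n r = β n) :
    HasSum (fun r => α r * ((-q) ^ r / (1 - q ^ (2 * r + 1))))
      (Jbar 1 4 q * ∑' n, qPoch q (q ^ 2) n * (-q) ^ n * β n) := by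
  -- A square root p of q provides A = p, B = -p. Only the products (p)_n (-p)_n = (q;q²)_n enter,
  -- so the choice of root is immaterial.
  obtain ⟨p, hp⟩ := IsAlgClosed.exists_pow_nat_eq q two_pos
  have hz : ‖-q‖ < 1 := by rwa [norm_neg]
  have hQ := norm_sq_lt_one hq1
  have hγ := hasSum_mul_baileyKernel (A := p) (B := -p) hq1 hz (by rw [← hp]; ring)
  have hδ := summable_norm_qPoch_mul_pow p (-p) hq1 hz
  simp only [qPoch_mul_neg, hp] at hγ hδ
  have h := ((hasSum_bailey_transform hq1 hδ hα hβ hγ).1).mul_left (Jbar 1 4 q)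
  have h1 := qPochInf_ne_zero hq1 (one_sub_pow_mul_ne_zero hq1 hq1)
  have h2 := qPochInf_ne_zero hq1 (one_sub_pow_mul_ne_zero hq1 hz)
  refine h.congr_fun fun r => ?_
  -- The two tails combine to (q^{2r+3};q²)_∞. Together with (q;q²)_r this is (q;q²)_∞ without its
  -- factor 1 - q^{2r+1}, the denominator of the claim.
  have h3 : qPochInf (q ^ r * (p * -q)) q * qPochInf (q ^ r * (-p * -q)) q =
      qPochInf ((q ^ 2) ^ (r + 1) * q) (q ^ 2) := by
    rw [show q ^ r * (-p * -q) = -(q ^ r * (p * -q)) by ring, qPochInf_mul_neg _ hq1, ← hp]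
    congr 1
    ring
  have h4 := qPochInf_eq_mul q hQ (r + 1)
  have h5 := Jbar_mul_qPochInf hq0 hq1
  have h6 : 1 - q ^ (2 * r + 1) ≠ 0 := one_sub_pow_ne_zero hq1 (2 * r).succ_ne_zero
  rw [h4, qPoch_succ, ← h3] at h5
  rw [mul_div_assoc', mul_div_assoc', mul_div_assoc', div_eq_div_iff h6 (mul_ne_zero h1 h2)]
  linear_combination (-α r * (-q) ^ r) * h5

/-- The Bailey transform in base `q²` with `δ_n = (-q; q)_{2n} q^n`. -/
theorem hasSum_bailey_sq {q : ℂ} (hq0 : q ≠ 0) (hq1 : ‖q‖ < 1) {α β : ℕ → ℂ}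
    (hα : Summable fun r => ‖α r‖)
    (hβ : ∀ n, ∑ r ∈ Finset.range (n + 1), α r * baileyKernel (q ^ 2) n r = β n) :
    HasSum (fun r => α r * (q ^ r / (1 + q ^ (2 * r + 1))))
      (J 1 2 q * ∑' n, qPoch (-q) q (2 * n) * q ^ n * β n) ∧
      Summable fun n => qPoch (-q) q (2 * n) * q ^ n * β n := by
  have hQ := norm_sq_lt_one hq1
  have hγ := hasSum_mul_baileyKernel (A := -q) (B := q * -q) hQ hq1 (by ring)
  have hδ := summable_norm_qPoch_mul_pow (-q) (q * -q) hQ hq1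
  simp only [← qPoch_two_mul] at hγ hδ
  have h := hasSum_bailey_transform hQ hδ hα hβ hγ
  refine ⟨(h.1.mul_left (J 1 2 q)).congr_fun fun r => ?_, h.2⟩
  have h1 := qPochInf_ne_zero hQ (one_sub_pow_mul_ne_zero hQ hq1)
  have h2 := qPochInf_ne_zero hQ (one_sub_pow_mul_ne_zero hQ hQ)
  have h3 := qPochInf_self_mul_neg hq1
  have h4 : 1 + q ^ (2 * r + 1) ≠ 0 := one_add_pow_ne_zero hq1 (2 * r).succ_ne_zero
  rw [qPochInf_eq_mul_sq _ hq1, qPochInf_eq_mul (-q) hQ (r + 1), qPochInf_eq_mul (q * -q) hQ r,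
    qPoch_succ, show (q ^ 2) ^ (r + 1) * -q = (q ^ 2) ^ r * (q * -q * q) by ring,
    show q * -q = -q * q by ring] at h3
  rw [J_eq hq0, qPoch_two_mul, show q * -q = -q * q by ring, mul_div_assoc', mul_div_assoc',
    mul_div_assoc', div_eq_div_iff h4 (mul_ne_zero h2 h1)]
  linear_combination (-α r * q ^ r * qPochInf q (q ^ 2) * qPochInf (q ^ 2) (q ^ 2)) * h3

/-! ### Absolute summability of the Bailey sequences -/

theorem norm_heckeCoeff_le {q : ℂ} (hq0 : q ≠ 0) (hq1 : ‖q‖ < 1) (r : ℕ) :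
    ‖heckeCoeff q r * (q ^ r)⁻¹‖ ≤ (2 * r + 1) * ‖q‖ ^ r * ‖q‖⁻¹ := by
  have hρ : 0 < ‖q‖ := norm_pos_iff.mpr hq0
  have h : heckeCoeff q r * (q ^ r)⁻¹ = ∑ j ∈ Finset.Icc (-(r : ℤ)) r,
      (-1) ^ j * q ^ (2 * (r : ℤ) ^ 2 - j * (3 * j - 1) / 2) := by
    rw [heckeCoeff, innerA, mul_right_comm, Finset.mul_sum]
    refine Finset.sum_congr rfl fun j _ => ?_
    rw [sub_eq_add_neg (2 * (r : ℤ) ^ 2), zpow_add₀ hq0, pow_add, mul_inv_cancel_right₀ (pow_ne_zero _ hq0),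
      show 2 * (r : ℤ) ^ 2 = ((2 * r ^ 2 : ℕ) : ℤ) by push_cast; ring, zpow_natCast]
    ring
  rw [h]
  refine (norm_sum_le_of_le _ (f := fun j : ℤ => (-1) ^ j * q ^ (2 * (r : ℤ) ^ 2 - j * (3 * j - 1) / 2))
    (n := fun _ => ‖q‖ ^ ((r : ℤ) - 1)) fun j hj => ?_).trans ?_
  · rw [norm_mul, norm_zpow, norm_zpow, norm_neg, norm_one, one_zpow, one_mul]
    refine zpow_le_zpow_right_of_le_one₀ hρ hq1.le ?_
    rw [Finset.mem_Icc] at hj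
    have h1 : j * (3 * j - 1) / 2 * 2 ≤ j * (3 * j - 1) := Int.ediv_mul_le _ (by norm_num)
    have h2 : 0 ≤ ((r : ℤ) - j) * (r + j) := mul_nonneg (by linarith) (by linarith)
    -- For |j| ≤ r the exponent 2r² - j(3j-1)/2 is at least (r² - r)/2, which exceeds r - 1 by
    -- (r-1)(r-2)/2. This is nonnegative at every integer.
    have h3 : 0 ≤ ((r : ℤ) - 1) * (r - 2) := by
      rcases le_or_gt (r : ℤ) 1 with h | h
      · exact mul_nonneg_of_nonpos_of_nonpos (by linarith) (by linarith)
      · exact mul_nonneg (by linarith) (by linarith)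
    nlinarith
  · rw [Finset.sum_const, Int.card_Icc, nsmul_eq_mul, zpow_sub₀ hρ.ne', zpow_natCast, zpow_one,
      div_eq_mul_inv, ← mul_assoc]
    have : (((r : ℤ) + 1 - -(r : ℤ)).toNat : ℝ) = 2 * r + 1 := by
      rw [show ((r : ℤ) + 1 - -(r : ℤ)).toNat = 2 * r + 1 by omega]
      push_cast
      ring
    rw [this]

theorem summable_two_mul_add_one_mul_pow {ρ : ℝ} (h0 : 0 ≤ ρ) (h1 : ρ < 1) :
    Summable fun n : ℕ => (2 * n + 1) * ρ ^ n := by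
  have h := summable_pow_mul_geometric_of_norm_lt_one 1
    (show ‖ρ‖ < 1 by rwa [Real.norm_of_nonneg h0])
  refine ((h.mul_left 2).add (summable_geometric_of_lt_one h0 h1)).congr fun n => ?_
  ring

theorem summable_norm_heckeCoeff_mul {q : ℂ} (hq0 : q ≠ 0) (hq1 : ‖q‖ < 1) {u : ℕ → ℂ} {C : ℝ}
    (hu : ∀ r, ‖u r‖ ≤ C) : Summable fun r => ‖heckeCoeff q r * (q ^ r)⁻¹ * u r‖ := by
  refine Summable.of_nonneg_of_le (fun _ => norm_nonneg _) (fun r => ?_)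
    (((summable_two_mul_add_one_mul_pow (norm_nonneg q) hq1).mul_right ‖q‖⁻¹).mul_right C)
  rw [norm_mul]
  exact mul_le_mul (norm_heckeCoeff_le hq0 hq1 r) (hu r) (norm_nonneg _) (by positivity)

theorem norm_one_sub_pow_le {q : ℂ} (hq1 : ‖q‖ < 1) (n : ℕ) : ‖1 - q ^ n‖ ≤ 2 := by
  refine (norm_sub_le _ _).trans ?_
  rw [norm_one, norm_pow]
  linarith [pow_le_one₀ (norm_nonneg q) hq1.le (n := n)]

theorem summable_norm_heckeCoeff_one {q : ℂ} (hq0 : q ≠ 0) (hq1 : ‖q‖ < 1) :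
    Summable fun r => ‖heckeCoeff q r * (1 - q ^ (2 * r + 1))‖ := by
  refine (summable_norm_heckeCoeff_mul hq0 hq1 (u := fun r => q ^ r * (1 - q ^ (2 * r + 1)))
    (C := 1 * 2) fun r => ?_).congr fun r => ?_
  · rw [norm_mul, norm_pow]
    exact mul_le_mul (pow_le_one₀ (norm_nonneg q) hq1.le) (norm_one_sub_pow_le hq1 _)
      (norm_nonneg _) zero_le_one
  · rw [← mul_assoc, inv_mul_cancel_right₀ (pow_ne_zero _ hq0)]

theorem summable_norm_heckeCoeff_two {q : ℂ} (hq0 : q ≠ 0) (hq1 : ‖q‖ < 1) :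
    Summable fun r => ‖heckeCoeff q r * (q ^ r)⁻¹ * (1 - q ^ (4 * r + 2))‖ :=
  summable_norm_heckeCoeff_mul hq0 hq1 fun _ => norm_one_sub_pow_le hq1 _

/-! ### Fine's transformation, and its use for φ and ν -/

/-- The series `∑ (x; q)_n t^n`. -/
noncomputable def fineSum (x q t : ℂ) : ℂ := ∑' n, qPoch x q n * t ^ n

theorem norm_qPoch_mul_pow_le (x : ℂ) {q : ℂ} (hq1 : ‖q‖ < 1) :
    ∃ C, 0 < C ∧ ∀ t n, ‖qPoch x q n * t ^ n‖ ≤ C * ‖t‖ ^ n := by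
  obtain ⟨C, hC, h⟩ := exists_norm_qPoch_le x hq1
  refine ⟨C, hC, fun t n => ?_⟩
  rw [norm_mul, norm_pow]
  gcongr
  exact h n

theorem summable_qPoch_mul_pow (x : ℂ) {q t : ℂ} (hq1 : ‖q‖ < 1) (ht : ‖t‖ < 1) :
    Summable fun n => qPoch x q n * t ^ n := by
  obtain ⟨C, -, h⟩ := norm_qPoch_mul_pow_le x hq1
  exact Summable.of_norm_bounded
    ((summable_geometric_of_lt_one (norm_nonneg t) ht).mul_left C) (h t)

theorem fineSum_step (x : ℂ) {q t : ℂ} (hq1 : ‖q‖ < 1) (ht : ‖t‖ < 1) :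
    (1 - t) * fineSum x q t = 1 - x * t * fineSum x q (q * t) := by
  have hs := summable_qPoch_mul_pow x hq1 ht
  have ht' : ‖q * t‖ < 1 := by
    rw [norm_mul]
    exact (mul_le_of_le_one_left (norm_nonneg t) hq1.le).trans_lt ht
  have hs' := summable_qPoch_mul_pow x hq1 ht'
  have h0 : HasSum (fun n => qPoch x q n * t ^ n) (fineSum x q t) := hs.hasSum
  have h0' : HasSum (fun n => qPoch x q n * (q * t) ^ n) (fineSum x q (q * t)) := hs'.hasSum
  have h1 := (h0.mul_left t).sub (h0'.mul_left (x * t))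
  have h2 : (fun n => t * (qPoch x q n * t ^ n) - x * t * (qPoch x q n * (q * t) ^ n)) =
      fun n => qPoch x q (n + 1) * t ^ (n + 1) := by
    ext n
    rw [qPoch_succ]
    ring
  rw [h2] at h1
  have h3 := h1.unique ((hasSum_nat_add_iff' 1).mpr h0)
  simp only [Finset.range_one, Finset.sum_singleton, qPoch_zero, pow_zero, mul_one] at h3
  linear_combination -h3

/-- N-fold iteration of (1-t) F(t) = 1 - xt F(qt). The partial sums are those of Fine's series, and
the remainder tends to zero when |x|, |t| < 1. -/
theorem fineSum_eq_sum_add (x : ℂ) {q t : ℂ} (hq1 : ‖q‖ < 1) (ht : ‖t‖ < 1) (N : ℕ) :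
    fineSum x q t = ∑ n ∈ Finset.range N, (-(x * t)) ^ n * q ^ n.choose 2 / qPoch t q (n + 1) +
      (-(x * t)) ^ N * q ^ N.choose 2 / qPoch t q N * fineSum x q (q ^ N * t) := by
  induction N with
  | zero => simp [qPoch]
  | succ N ih =>
    have ht' : ‖q ^ N * t‖ < 1 := by
      rw [norm_mul, norm_pow]
      exact (mul_le_of_le_one_left (norm_nonneg t)
        (pow_le_one₀ (norm_nonneg q) hq1.le)).trans_lt ht
    have h := fineSum_step x hq1 ht'
    have h1 := one_sub_pow_mul_ne_zero hq1 ht N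
    have h2 := qPoch_ne_zero (one_sub_pow_mul_ne_zero hq1 ht) N
    rw [← mul_assoc q, ← pow_succ'] at h
    have h3 : fineSum x q (q ^ N * t) =
        (1 - x * (q ^ N * t) * fineSum x q (q ^ (N + 1) * t)) / (1 - q ^ N * t) := by
      rw [eq_div_iff h1, ← h]; ring
    rw [Finset.sum_range_succ, ih, h3, qPoch_succ, Nat.choose_succ_succ' N 1, Nat.choose_one_right,
      pow_add q N, pow_succ (-(x * t)), add_assoc]
    congr 1
    rw [div_mul_div_comm, div_mul_eq_mul_div, ← add_div]
    congr 1
    ring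

/-- Fine's transformation `∑ (x; q)_n t^n = ∑ (-xt)^n q^{n(n-1)/2} / (t; q)_{n+1}`. -/
theorem hasSum_fineSum {x q t : ℂ} (hq1 : ‖q‖ < 1) (ht : ‖t‖ < 1) (hx : ‖x‖ < 1) :
    HasSum (fun n => (-(x * t)) ^ n * q ^ n.choose 2 / qPoch t q (n + 1)) (fineSum x q t) := by
  obtain ⟨C, hC, h⟩ := exists_norm_qPoch_inv_le hq1 (one_sub_pow_mul_ne_zero hq1 ht)
  obtain ⟨D, hD, h'⟩ := norm_qPoch_mul_pow_le x hq1
  have hxt : ‖-(x * t)‖ < 1 := by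
    rw [norm_neg, norm_mul]
    exact mul_lt_one_of_nonneg_of_lt_one_left (norm_nonneg x) hx ht.le
  have hb : ∀ n m, ‖(-(x * t)) ^ n * q ^ n.choose 2 / qPoch t q m‖ ≤ C * ‖-(x * t)‖ ^ n := by
    intro n m
    rw [div_eq_mul_inv, norm_mul, norm_mul, norm_pow, norm_pow]
    calc _ ≤ ‖-(x * t)‖ ^ n * 1 * C := by
          gcongr
          exacts [pow_le_one₀ (norm_nonneg q) hq1.le, h m]
      _ = _ := by ring
  have hs : Summable (fun n : ℕ => (-(x * t)) ^ n * q ^ n.choose 2 / qPoch t q (n + 1)) :=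
    Summable.of_norm_bounded ((summable_geometric_of_lt_one (norm_nonneg _) hxt).mul_left C)
      fun n => hb n _
  rw [hs.hasSum_iff_tendsto_nat]
  have hF : ∀ N, ‖fineSum x q (q ^ N * t)‖ ≤ D * (1 - ‖t‖)⁻¹ := by
    intro N
    have hle : ‖q ^ N * t‖ ≤ ‖t‖ := by
      rw [norm_mul, norm_pow]
      exact mul_le_of_le_one_left (norm_nonneg t) (pow_le_one₀ (norm_nonneg q) hq1.le)
    refine tsum_of_norm_bounded ((hasSum_geometric_of_lt_one (norm_nonneg t) ht).mul_left D)
      fun n => (h' _ n).trans ?_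
    gcongr
  have hr : Tendsto (fun N : ℕ => (-(x * t)) ^ N * q ^ N.choose 2 / qPoch t q N *
      fineSum x q (q ^ N * t)) atTop (𝓝 0) := by
    refine squeeze_zero_norm
      (a := fun N => C * ‖-(x * t)‖ ^ N * (D * (1 - ‖t‖)⁻¹)) (fun N => ?_) ?_
    · rw [norm_mul]
      exact mul_le_mul (hb N N) (hF N) (norm_nonneg _) (by positivity)
    · simpa using ((tendsto_pow_atTop_nhds_zero_of_lt_one (norm_nonneg _) hxt).const_mul C).mul_const
        (D * (1 - ‖t‖)⁻¹)
  have := hr.const_sub (fineSum x q t)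
  rw [sub_zero] at this
  refine this.congr fun N => ?_
  rw [fineSum_eq_sum_add x hq1 ht N, add_sub_cancel_right]

theorem two_mul_choose_two (n : ℕ) : 2 * n.choose 2 + n = n ^ 2 := by
  induction n with
  | zero => rfl
  | succ n ih =>
    rw [Nat.choose_succ_succ' n 1, Nat.choose_one_right]
    linarith

theorem hasSum_nuTerm {q : ℂ} (hq1 : ‖q‖ < 1) :
    HasSum (nuTerm q) (fineSum q (q ^ 2) (-q)) := by
  refine (hasSum_fineSum (norm_sq_lt_one hq1) (by rwa [norm_neg]) hq1).congr_fun fun n => ?_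
  rw [nuTerm, show -(q * -q) = q ^ 2 by ring, ← pow_add, ← pow_mul]
  congr 2
  linarith [two_mul_choose_two n]

/-- Fine's series in base q² at x = q, t = -q², multiplied by q, has n-th term
q^{(n+1)²}/(-q²;q²)_{n+1}: it is φ without its term of index 0. -/
theorem hasSum_phiTerm {q : ℂ} (hq1 : ‖q‖ < 1) :
    HasSum (phiTerm q) (1 + q * fineSum q (q ^ 2) (-q ^ 2)) := by
  have h := (hasSum_fineSum (norm_sq_lt_one hq1) (t := -q ^ 2)
    (by rw [norm_neg]; exact norm_sq_lt_one hq1) hq1).mul_left q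
  rw [← hasSum_nat_add_iff' 1]
  simp only [Finset.range_one, Finset.sum_singleton]
  rw [show phiTerm q 0 = 1 by simp [phiTerm, qPoch], add_sub_cancel_left]
  refine h.congr_fun fun n => ?_
  rw [phiTerm, mul_div_assoc', show -(q * -q ^ 2) = q ^ 3 by ring, ← pow_mul, ← pow_mul, ← pow_add,
    ← pow_succ']
  congr 2
  linarith [two_mul_choose_two n]

/-! ### The single-sum Hecke forms -/

theorem hasSum_nu {q : ℂ} (hq0 : q ≠ 0) (hq1 : ‖q‖ < 1) :
    HasSum (fun n : ℕ => (-1) ^ n * q ^ (2 * n ^ 2 + 2 * n) * innerA q n) (Jbar 1 4 q * nu q) := by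
  have h := hasSum_bailey_neg hq0 hq1 (summable_norm_heckeCoeff_one hq0 hq1)
    (sum_heckeCoeff_mul_baileyKernel hq0 hq1)
  rw [nu, (hasSum_nuTerm hq1).tsum_eq, fineSum]
  simp only [mul_one] at h
  refine h.congr_fun fun n => ?_
  have h1 : 1 - q ^ (2 * n + 1) ≠ 0 := one_sub_pow_ne_zero hq1 (2 * n).succ_ne_zero
  rw [mul_assoc (heckeCoeff q n), mul_div_cancel₀ _ h1, heckeCoeff, neg_pow]
  ring

theorem hasSum_phi {q : ℂ} (hq0 : q ≠ 0) (hq1 : ‖q‖ < 1) :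
    HasSum (fun n : ℕ => (-1) ^ n * q ^ (2 * n ^ 2 + n) * (1 + q ^ (2 * n + 1)) * innerA q n)
      (Jbar 1 4 q * phi q) := by
  have h := hasSum_bailey_neg hq0 hq1 (summable_norm_heckeCoeff_two hq0 hq1)
    (sum_heckeCoeff_mul_baileyKernel' hq0 hq1)
  have h0 : HasSum (fun n => qPoch q (q ^ 2) n * (-q) ^ n * (q ^ (n + 1) + if n = 0 then 1 else 0))
      (q * fineSum q (q ^ 2) (-q ^ 2) + 1) := by
    have h1 : HasSum (fun n => qPoch q (q ^ 2) n * (-q ^ 2) ^ n) (fineSum q (q ^ 2) (-q ^ 2)) :=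
      (summable_qPoch_mul_pow q (norm_sq_lt_one hq1)
        (by rw [norm_neg]; exact norm_sq_lt_one hq1)).hasSum
    refine ((h1.mul_left q).add (hasSum_ite_eq 0 1)).congr_fun fun n => ?_
    split_ifs with hn
    · subst hn; simp [qPoch]
    · rw [neg_pow (q ^ 2), neg_pow q]; ring
  rw [phi, (hasSum_phiTerm hq1).tsum_eq, add_comm, ← h0.tsum_eq]
  refine h.congr_fun fun n => ?_
  have h1 : 1 - q ^ (2 * n + 1) ≠ 0 := one_sub_pow_ne_zero hq1 (2 * n).succ_ne_zero
  rw [show 1 - q ^ (4 * n + 2) = (1 + q ^ (2 * n + 1)) * (1 - q ^ (2 * n + 1)) by ring,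
    ← mul_assoc, mul_assoc _ (1 - q ^ (2 * n + 1)), mul_div_cancel₀ _ h1, heckeCoeff, neg_pow q]
  have h2 : q ^ n ≠ 0 := pow_ne_zero _ hq0
  field_simp

theorem innerB_eq (q : ℂ) (n : ℕ) : innerB q n = innerA (q ^ 2) n := by
  refine Finset.sum_nbij' (fun j => -j) (fun j => -j) ?_ ?_ (fun _ _ => neg_neg _)
    (fun _ _ => neg_neg _) ?_
  · intro j hj; simp only [Finset.mem_Icc] at *; omega
  · intro j hj; simp only [Finset.mem_Icc] at *; omega
  · intro j _
    have h1 : 2 * tri (-j) = -j * (-j - 1) := two_mul_tri (-j)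
    have h2 : -j * (3 * -j - 1) / 2 = j ^ 2 + tri (-j) := by
      apply Int.ediv_eq_of_eq_mul_right (by norm_num)
      linear_combination -h1
    rw [h2, zpow_neg (-1 : ℂ), ← inv_zpow, inv_neg_one, ← zpow_natCast q 2, ← zpow_mul]
    congr 2
    push_cast
    linear_combination h1

theorem bailey_phibar1 {q : ℂ} (hq0 : q ≠ 0) (hq1 : ‖q‖ < 1) :
    HasSum (fun n : ℕ => q ^ (4 * n ^ 2 + 3 * n) * (1 - q ^ (2 * n + 1)) * innerB q n)
      (J 1 2 q * phibar1 q) ∧ Summable (phibar1Term q) := by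
  have hQ0 : q ^ 2 ≠ 0 := pow_ne_zero _ hq0
  have hQ := norm_sq_lt_one hq1
  have h := hasSum_bailey_sq hq0 hq1 (summable_norm_heckeCoeff_one hQ0 hQ)
    (sum_heckeCoeff_mul_baileyKernel hQ0 hQ)
  have e : (fun n => qPoch (-q) q (2 * n) * q ^ n * 1) = phibar1Term q := by
    ext n; rw [phibar1Term]; ring
  rw [e] at h
  refine ⟨h.1.congr_fun fun n => ?_, h.2⟩
  have h1 := one_add_pow_ne_zero hq1 (2 * n).succ_ne_zero
  rw [innerB_eq, heckeCoeff]
  field_simp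
  ring

theorem bailey_phibar0 {q : ℂ} (hq0 : q ≠ 0) (hq1 : ‖q‖ < 1) :
    HasSum (fun n : ℕ => q ^ (4 * n ^ 2 + n) * (1 - q ^ (6 * n + 3)) * innerB q n)
      (J 1 2 q * (q * phibar0 q + 1)) ∧ Summable (phibar0Term q) := by
  have hQ0 : q ^ 2 ≠ 0 := pow_ne_zero _ hq0
  have hQ := norm_sq_lt_one hq1
  obtain ⟨h1, s1⟩ := hasSum_bailey_sq hq0 hq1 (summable_norm_heckeCoeff_one hQ0 hQ)
    (sum_heckeCoeff_mul_baileyKernel hQ0 hQ)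
  obtain ⟨h2, s2⟩ := hasSum_bailey_sq hq0 hq1 (summable_norm_heckeCoeff_two hQ0 hQ)
    (sum_heckeCoeff_mul_baileyKernel' hQ0 hQ)
  have hs := (s1.hasSum.mul_left q).add s2.hasSum
  -- The last factor of (-q;q)_{2n+1} is 1 + q^{2n+1}, so q^{n+1}(-q;q)_{2n+1} = δ_n (q + q^{2n+2})
  -- with δ_n = (-q;q)_{2n} q^n. This is q times the first β plus the second in base q², less the
  -- indicator of n = 0, which accounts for the +1 in qφ̄₀ + 1.
  have e : ∀ n, q * phibar0Term q n = q * (qPoch (-q) q (2 * n) * q ^ n * 1) +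
      qPoch (-q) q (2 * n) * q ^ n * ((q ^ 2) ^ (n + 1) + if n = 0 then 1 else 0) -
        if n = 0 then 1 else 0 := by
    intro n
    rw [phibar0Term, qPoch_succ]
    split_ifs with hn
    · subst hn
      simp [qPoch]
      ring
    · ring
  have h3 := (hs.sub (hasSum_ite_eq 0 1)).congr_fun e
  have h4 : Summable (phibar0Term q) := by
    refine (h3.summable.mul_left q⁻¹).congr fun n => ?_
    rw [inv_mul_cancel_left₀ hq0]
  have h5 := (h4.hasSum.mul_left q).unique h3
  refine ⟨?_, h4⟩
  have h6 : J 1 2 q * (q * phibar0 q + 1) =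
      q * (J 1 2 q * ∑' n, qPoch (-q) q (2 * n) * q ^ n * 1) + J 1 2 q * ∑' n,
        qPoch (-q) q (2 * n) * q ^ n * ((q ^ 2) ^ (n + 1) + if n = 0 then 1 else 0) := by
    rw [phibar0, h5]
    ring
  rw [h6]
  refine ((h1.mul_left q).add h2).congr_fun fun n => ?_
  have h7 : 1 + q ^ (2 * n + 1) ≠ 0 := one_add_pow_ne_zero hq1 (2 * n).succ_ne_zero
  -- With y = q^{2n+1}, the two contributions add up through (1 - y)(1 + y + y²) = 1 - y³, whence
  -- the factor 1 - q^{6n+3}.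
  have e1 : (1 - (q ^ 2) ^ (2 * n + 1)) * (q ^ n / (1 + q ^ (2 * n + 1))) =
      (1 - q ^ (2 * n + 1)) * q ^ n := by
    rw [mul_div_assoc', div_eq_iff h7]
    ring
  have e2 : (1 - (q ^ 2) ^ (4 * n + 2)) * (q ^ n / (1 + q ^ (2 * n + 1))) =
      (1 - q ^ (2 * n + 1)) * (1 + q ^ (4 * n + 2)) * q ^ n := by
    rw [mul_div_assoc', div_eq_iff h7]
    ring
  have e3 : (q ^ 2) ^ (2 * n ^ 2 + n) * ((q ^ 2) ^ n)⁻¹ = q ^ (4 * n ^ 2) := by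
    rw [pow_add, mul_inv_cancel_right₀ (pow_ne_zero _ hQ0)]
    ring
  rw [innerB_eq, heckeCoeff]
  linear_combination (-q * (q ^ 2) ^ (2 * n ^ 2 + n) * innerA (q ^ 2) n) * e1 -
    ((q ^ 2) ^ (2 * n ^ 2 + n) * ((q ^ 2) ^ n)⁻¹ * innerA (q ^ 2) n) * e2 -
    (innerA (q ^ 2) n * (1 - q ^ (2 * n + 1)) * (1 + q ^ (4 * n + 2)) * q ^ n) * e3

/-! ### Indefinite sums over the cone |j| ≤ n -/

/-- The pairs `(n, j)` with `|j| ≤ n`. -/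
abbrev Cone : Type := {p : ℤ × ℤ // 0 ≤ p.1 + p.2 ∧ 0 ≤ p.1 - p.2}

/-- The pairs `(n, j)` with `|j| ≤ -n - 1`. -/
abbrev NegCone : Type := {p : ℤ × ℤ // p.1 + p.2 < 0 ∧ p.1 - p.2 < 0}

/-- The reflection `n ↦ -1 - n`. -/
def coneReflection : Cone ≃ NegCone where
  toFun p := ⟨(-1 - p.1.1, p.1.2), by have := p.2; dsimp only; omega⟩
  invFun p := ⟨(-1 - p.1.1, p.1.2), by have := p.2; dsimp only; omega⟩
  left_inv p := by ext <;> simp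
  right_inv p := by ext <;> simp

/-- The cone is fibred over its first coordinate. -/
def coneEquivSigma : (Σ n : ℕ, {j : ℤ // j ∈ Finset.Icc (-(n : ℤ)) n}) ≃ Cone where
  toFun x := ⟨(x.1, x.2), by have := Finset.mem_Icc.mp x.2.2; dsimp only; omega⟩
  invFun p := ⟨p.1.1.toNat, p.1.2, by have := p.2; rw [Finset.mem_Icc]; omega⟩
  left_inv x := by rcases x with ⟨n, j, hj⟩; simp
  right_inv p := by
    have h := p.2
    have h0 : ((p.1.1.toNat : ℕ) : ℤ) = p.1.1 := Int.toNat_of_nonneg (by omega)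
    ext
    · exact h0
    · rfl

/-- The cone is the union of its points with `n + j` even and those with `n + j` odd. -/
noncomputable def coneEquivSum : (ℕ × ℕ) ⊕ (ℕ × ℕ) ≃ Cone :=
  Equiv.ofBijective
    (Sum.elim (fun x => ⟨((x.1 : ℤ) + x.2, (x.1 : ℤ) - x.2), by dsimp only; omega⟩)
      (fun x => ⟨((x.1 : ℤ) + x.2 + 1, (x.1 : ℤ) - x.2), by dsimp only; omega⟩)) <| by
    constructor
    · rintro (⟨a, b⟩ | ⟨a, b⟩) (⟨c, d⟩ | ⟨c, d⟩) h <;>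
        simp only [Sum.elim_inl, Sum.elim_inr, Subtype.mk.injEq, Prod.mk.injEq, Sum.inl.injEq,
          Sum.inr.injEq, reduceCtorEq] at h ⊢ <;> omega
    · rintro ⟨⟨n, j⟩, h1, h2⟩
      dsimp only at h1 h2
      rcases Int.even_or_odd' (n + j) with ⟨k, hk | hk⟩
      · refine ⟨Sum.inl (k.toNat, (k - j).toNat), ?_⟩
        simp only [Sum.elim_inl, Subtype.mk.injEq, Prod.mk.injEq]
        omega
      · refine ⟨Sum.inr (k.toNat, (k - j).toNat), ?_⟩
        simp only [Sum.elim_inr, Subtype.mk.injEq, Prod.mk.injEq]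
        omega

/-- The pairs `(r, s)` of equal sign, both non-negative or both negative. -/
noncomputable def sameSignEquivSum : (ℕ × ℕ) ⊕ (ℕ × ℕ) ≃ {p : ℤ × ℤ // sg p.1 = sg p.2} :=
  Equiv.ofBijective
    (Sum.elim (fun x => ⟨((x.1 : ℤ), (x.2 : ℤ)), by simp [sg]⟩)
      (fun x => ⟨(-x.1 - 1, -x.2 - 1), by
        dsimp only [sg]; rw [if_neg (by omega), if_neg (by omega)]⟩)) <| by
    constructor
    · rintro (⟨a, b⟩ | ⟨a, b⟩) (⟨c, d⟩ | ⟨c, d⟩) h <;>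
        simp only [Sum.elim_inl, Sum.elim_inr, Subtype.mk.injEq, Prod.mk.injEq, Sum.inl.injEq,
          Sum.inr.injEq, reduceCtorEq] at h ⊢ <;> omega
    · rintro ⟨⟨r, s⟩, h⟩
      dsimp only [sg] at h
      rcases le_or_gt 0 r with hr | hr <;> rcases le_or_gt 0 s with hs | hs
      · exact ⟨Sum.inl (r.toNat, s.toNat), Subtype.ext
          (Prod.ext (Int.toNat_of_nonneg hr) (Int.toNat_of_nonneg hs))⟩
      · rw [if_pos hr, if_neg (by omega)] at h; omega
      · rw [if_neg (by omega), if_pos hs] at h; omega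
      · refine ⟨Sum.inr ((-r - 1).toNat, (-s - 1).toNat), Subtype.ext (Prod.ext ?_ ?_)⟩
        · change -((-r - 1).toNat : ℤ) - 1 = r
          omega
        · change -((-s - 1).toNat : ℤ) - 1 = s
          omega

theorem summable_pow_add {ρ : ℝ} (h0 : 0 ≤ ρ) (h1 : ρ < 1) :
    Summable fun p : ℕ × ℕ => ρ ^ (p.1 + p.2) := by
  simp only [pow_add]
  exact (summable_geometric_of_lt_one h0 h1).mul_of_nonneg (summable_geometric_of_lt_one h0 h1)
    (fun _ => by positivity) (fun _ => by positivity)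

section Cone

variable {g : ℤ → ℤ → ℂ} {ρ : ℝ}

theorem summable_cone_even (h0 : 0 < ρ) (h1 : ρ < 1)
    (hg : ∀ n j : ℤ, 0 ≤ n + j → 0 ≤ n - j → ‖g n j‖ ≤ ρ ^ n) :
    Summable fun p : ℕ × ℕ => g (p.1 + p.2) (p.1 - p.2) := by
  refine Summable.of_norm_bounded (summable_pow_add h0.le h1) fun p => ?_
  refine (hg _ _ (by omega) (by omega)).trans_eq ?_
  rw [← zpow_natCast]
  push_cast
  rfl

theorem summable_cone_odd (h0 : 0 < ρ) (h1 : ρ < 1)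
    (hg : ∀ n j : ℤ, 0 ≤ n + j → 0 ≤ n - j → ‖g n j‖ ≤ ρ ^ n) :
    Summable fun p : ℕ × ℕ => g (p.1 + p.2 + 1) (p.1 - p.2) := by
  refine Summable.of_norm_bounded (summable_pow_add h0.le h1) fun p => ?_
  refine (hg _ _ (by omega) (by omega)).trans ?_
  rw [← zpow_natCast]
  refine zpow_le_zpow_right_of_le_one₀ h0 h1.le ?_
  push_cast
  omega

theorem hasSum_cone (h0 : 0 < ρ) (h1 : ρ < 1)
    (hg : ∀ n j : ℤ, 0 ≤ n + j → 0 ≤ n - j → ‖g n j‖ ≤ ρ ^ n) :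
    HasSum (fun p : Cone => g p.1.1 p.1.2)
      (∑' p : ℕ × ℕ, g (p.1 + p.2) (p.1 - p.2) + ∑' p : ℕ × ℕ, g (p.1 + p.2 + 1) (p.1 - p.2)) := by
  rw [← coneEquivSum.hasSum_iff]
  exact HasSum.sum (summable_cone_even h0 h1 hg).hasSum (summable_cone_odd h0 h1 hg).hasSum

theorem hasSum_cone_fiberwise (h0 : 0 < ρ) (h1 : ρ < 1)
    (hg : ∀ n j : ℤ, 0 ≤ n + j → 0 ≤ n - j → ‖g n j‖ ≤ ρ ^ n) :
    HasSum (fun n : ℕ => ∑ j ∈ Finset.Icc (-(n : ℤ)) n, g n j)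
      (∑' p : ℕ × ℕ, g (p.1 + p.2) (p.1 - p.2) + ∑' p : ℕ × ℕ, g (p.1 + p.2 + 1) (p.1 - p.2)) := by
  refine (coneEquivSigma.hasSum_iff.mpr (hasSum_cone h0 h1 hg)).sigma fun n => ?_
  exact Finset.hasSum (Finset.Icc (-(n : ℤ)) n) (g n)

theorem hasIndefSum_of_norm_le (h0 : 0 < ρ) (h1 : ρ < 1)
    (hg : ∀ n j : ℤ, 0 ≤ n + j → 0 ≤ n - j → ‖g n j‖ ≤ ρ ^ n)
    (hg' : ∀ n j : ℤ, 0 ≤ n + j → 0 ≤ n - j → ‖g (-1 - n) j‖ ≤ ρ ^ n) :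
    HasIndefSum g
      ((∑' p : ℕ × ℕ, g (p.1 + p.2) (p.1 - p.2) + ∑' p : ℕ × ℕ, g (p.1 + p.2 + 1) (p.1 - p.2)) -
        (∑' p : ℕ × ℕ, g (-1 - (p.1 + p.2)) (p.1 - p.2) +
          ∑' p : ℕ × ℕ, g (-1 - (p.1 + p.2 + 1)) (p.1 - p.2))) := by
  refine ⟨_, _, hasSum_cone h0 h1 hg, ?_, rfl⟩
  rw [← coneReflection.hasSum_iff]
  exact hasSum_cone (g := fun n j => g (-1 - n) j) h0 h1 hg'

/-- Folding the negative cone onto the positive one by n ↦ -1-n and summing over j first. The value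
is written with the same parity pieces as in `hasIndefSum_of_norm_le`, so uniqueness of sums links
the single-sum and indefinite forms. -/
theorem hasSum_blocks (h0 : 0 < ρ) (h1 : ρ < 1)
    (hg : ∀ n j : ℤ, 0 ≤ n + j → 0 ≤ n - j → ‖g n j‖ ≤ ρ ^ n)
    (hg' : ∀ n j : ℤ, 0 ≤ n + j → 0 ≤ n - j → ‖g (-1 - n) j‖ ≤ ρ ^ n) :
    HasSum (fun n : ℕ => ∑ j ∈ Finset.Icc (-(n : ℤ)) n, (g n j - g (-1 - n) j))
      ((∑' p : ℕ × ℕ, g (p.1 + p.2) (p.1 - p.2) + ∑' p : ℕ × ℕ, g (p.1 + p.2 + 1) (p.1 - p.2)) -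
        (∑' p : ℕ × ℕ, g (-1 - (p.1 + p.2)) (p.1 - p.2) +
          ∑' p : ℕ × ℕ, g (-1 - (p.1 + p.2 + 1)) (p.1 - p.2))) := by
  simp only [Finset.sum_sub_distrib]
  exact (hasSum_cone_fiberwise h0 h1 hg).sub
    (hasSum_cone_fiberwise (g := fun n j => g (-1 - n) j) h0 h1 hg')

end Cone

/-! ### Hecke-type sums as parity pieces of the cone -/

theorem hasSum_fTerm {a b c : ℤ} {x y q k : ℂ} {T : ℤ → ℤ → ℂ} (hk : k ≠ 0)
    (hT : ∀ r s : ℤ, k * ((-1) ^ (r + s) * x ^ r * y ^ s *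
      q ^ (a * (r * (r - 1) / 2) + b * r * s + c * (s * (s - 1) / 2))) = T r s)
    (h1 : Summable fun p : ℕ × ℕ => T p.1 p.2)
    (h2 : Summable fun p : ℕ × ℕ => T (-p.1 - 1) (-p.2 - 1)) :
    Summable (fTerm a b c x y q) ∧
      k * f a b c x y q = ∑' p : ℕ × ℕ, T p.1 p.2 - ∑' p : ℕ × ℕ, T (-p.1 - 1) (-p.2 - 1) := by
  have h : HasSum (fun p => k * fTerm a b c x y q p)
      (∑' p : ℕ × ℕ, T p.1 p.2 + -∑' p : ℕ × ℕ, T (-p.1 - 1) (-p.2 - 1)) := by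
    -- The negative quadrant is parametrized by (-p-1, -p'-1), where sg = -1 produces the
    -- subtraction.
    rw [← sameSignEquivSum.hasSum_iff]
    refine HasSum.sum (h1.hasSum.congr_fun fun p => ?_) (h2.hasSum.neg.congr_fun fun p => ?_)
    · change k * ((sg (p.1 : ℤ) : ℂ) * (-1) ^ ((p.1 : ℤ) + p.2) * x ^ (p.1 : ℤ) * y ^ (p.2 : ℤ) *
        q ^ (a * ((p.1 : ℤ) * (p.1 - 1) / 2) + b * p.1 * p.2 + c * ((p.2 : ℤ) * (p.2 - 1) / 2))) = _
      rw [← hT, sg, if_pos (by omega), Int.cast_one, one_mul]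
    · change k * ((sg (-(p.1 : ℤ) - 1) : ℂ) * (-1) ^ ((-(p.1 : ℤ) - 1) + (-p.2 - 1)) *
        x ^ (-(p.1 : ℤ) - 1) * y ^ (-(p.2 : ℤ) - 1) *
        q ^ (a * ((-(p.1 : ℤ) - 1) * (-p.1 - 1 - 1) / 2) + b * (-p.1 - 1) * (-p.2 - 1) +
          c * ((-(p.2 : ℤ) - 1) * (-p.2 - 1 - 1) / 2))) = _
      rw [← hT, sg, if_neg (by omega), Int.cast_neg, Int.cast_one]
      ring
  have hs : Summable (fTerm a b c x y q) := (summable_mul_left_iff hk).mp h.summable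
  refine ⟨hs, ?_⟩
  rw [f, sub_eq_add_neg, ← h.tsum_eq, tsum_mul_left]

theorem tsum_prod_swap (h : ℕ → ℕ → ℂ) :
    ∑' p : ℕ × ℕ, h p.2 p.1 = ∑' p : ℕ × ℕ, h p.1 p.2 :=
  (Equiv.prodComm ℕ ℕ).tsum_eq fun p => h p.1 p.2

theorem summable_prod_swap {h : ℕ → ℕ → ℂ} (hs : Summable fun p : ℕ × ℕ => h p.1 p.2) :
    Summable fun p : ℕ × ℕ => h p.2 p.1 :=
  (Equiv.prodComm ℕ ℕ).summable_iff.mpr hs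

section Assembly

variable {g : ℤ → ℤ → ℂ} {ρ : ℝ}

/-- The even part of the indefinite sum of `g` is a Hecke-type sum, with `n = r + s` and
`j = r - s`. -/
theorem f_eq_even {x y q : ℂ} (h0 : 0 < ρ) (h1 : ρ < 1)
    (hg : ∀ n j : ℤ, 0 ≤ n + j → 0 ≤ n - j → ‖g n j‖ ≤ ρ ^ n)
    (hg' : ∀ n j : ℤ, 0 ≤ n + j → 0 ≤ n - j → ‖g (-1 - n) j‖ ≤ ρ ^ n)
    (hT : ∀ r s : ℤ, (-1) ^ (r + s) * x ^ r * y ^ s *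
      q ^ (1 * (r * (r - 1) / 2) + 7 * r * s + 1 * (s * (s - 1) / 2)) = g (r + s) (r - s)) :
    Summable (fTerm 1 7 1 x y q) ∧ f 1 7 1 x y q =
      ∑' p : ℕ × ℕ, g (p.1 + p.2) (p.1 - p.2) -
        ∑' p : ℕ × ℕ, g (-1 - (p.1 + p.2 + 1)) (p.1 - p.2) := by
  -- On the negative quadrant r + s = -1 - (p + p' + 1): an even piece of the cone is paired with
  -- the odd piece of the reflected cone.
  have e : (fun p : ℕ × ℕ => g ((-p.1 - 1) + (-p.2 - 1)) ((-p.1 - 1) - (-p.2 - 1))) =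
      fun p : ℕ × ℕ => g (-1 - (p.2 + p.1 + 1)) (p.2 - p.1) := by
    ext p; congr 1 <;> ring
  have hs := summable_prod_swap (h := fun r s => g (-1 - (r + s + 1)) (r - s))
    (summable_cone_odd (g := fun n j => g (-1 - n) j) h0 h1 hg')
  have h := hasSum_fTerm (T := fun r s => g (r + s) (r - s)) one_ne_zero
    (fun r s => by rw [one_mul]; exact hT r s) (summable_cone_even h0 h1 hg) (by rw [e]; exact hs)
  rw [e, one_mul, tsum_prod_swap fun r s => g (-1 - (r + s + 1)) (r - s)] at h
  exact h

/-- The variant of `f_eq_even` with `j = s - r`. -/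
theorem f_eq_even_swap {x y q : ℂ} (h0 : 0 < ρ) (h1 : ρ < 1)
    (hg : ∀ n j : ℤ, 0 ≤ n + j → 0 ≤ n - j → ‖g n j‖ ≤ ρ ^ n)
    (hg' : ∀ n j : ℤ, 0 ≤ n + j → 0 ≤ n - j → ‖g (-1 - n) j‖ ≤ ρ ^ n)
    (hT : ∀ r s : ℤ, (-1) ^ (r + s) * x ^ r * y ^ s *
      q ^ (1 * (r * (r - 1) / 2) + 7 * r * s + 1 * (s * (s - 1) / 2)) = g (r + s) (s - r)) :
    Summable (fTerm 1 7 1 x y q) ∧ f 1 7 1 x y q =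
      ∑' p : ℕ × ℕ, g (p.1 + p.2) (p.1 - p.2) -
        ∑' p : ℕ × ℕ, g (-1 - (p.1 + p.2 + 1)) (p.1 - p.2) := by
  have e : (fun p : ℕ × ℕ => g ((-p.1 - 1) + (-p.2 - 1)) ((-p.2 - 1) - (-p.1 - 1))) =
      fun p : ℕ × ℕ => g (-1 - (p.1 + p.2 + 1)) (p.1 - p.2) := by
    ext p; congr 1 <;> ring
  have e' : (fun p : ℕ × ℕ => g (p.1 + p.2) (p.2 - p.1)) =
      fun p : ℕ × ℕ => g (p.2 + p.1) (p.2 - p.1) := by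
    ext p; rw [add_comm]
  have hs := summable_prod_swap (h := fun r s => g (r + s) (r - s)) (summable_cone_even h0 h1 hg)
  have h := hasSum_fTerm (T := fun r s => g (r + s) (s - r)) one_ne_zero
    (fun r s => by rw [one_mul]; exact hT r s) (by rw [e']; exact hs)
    (by rw [e]; exact summable_cone_odd (g := fun n j => g (-1 - n) j) h0 h1 hg')
  rw [e, e', one_mul, tsum_prod_swap fun r s => g (r + s) (r - s)] at h
  exact h

/-- The odd part of the indefinite sum of `g` is a Hecke-type sum, with `n = r + s + 1` and
`j = r - s`. -/
theorem f_eq_odd {x y q k : ℂ} (hk : k ≠ 0) (h0 : 0 < ρ) (h1 : ρ < 1)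
    (hg : ∀ n j : ℤ, 0 ≤ n + j → 0 ≤ n - j → ‖g n j‖ ≤ ρ ^ n)
    (hg' : ∀ n j : ℤ, 0 ≤ n + j → 0 ≤ n - j → ‖g (-1 - n) j‖ ≤ ρ ^ n)
    (hT : ∀ r s : ℤ, k * ((-1) ^ (r + s) * x ^ r * y ^ s *
      q ^ (1 * (r * (r - 1) / 2) + 7 * r * s + 1 * (s * (s - 1) / 2))) = g (r + s + 1) (r - s)) :
    Summable (fTerm 1 7 1 x y q) ∧ k * f 1 7 1 x y q =
      ∑' p : ℕ × ℕ, g (p.1 + p.2 + 1) (p.1 - p.2) -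
        ∑' p : ℕ × ℕ, g (-1 - (p.1 + p.2)) (p.1 - p.2) := by
  have e : (fun p : ℕ × ℕ => g ((-p.1 - 1) + (-p.2 - 1) + 1) ((-p.1 - 1) - (-p.2 - 1))) =
      fun p : ℕ × ℕ => g (-1 - (p.2 + p.1)) (p.2 - p.1) := by
    ext p; congr 1 <;> ring
  have hs := summable_prod_swap (h := fun r s => g (-1 - (r + s)) (r - s))
    (summable_cone_even (g := fun n j => g (-1 - n) j) h0 h1 hg')
  have h := hasSum_fTerm (T := fun r s => g (r + s + 1) (r - s)) hk hT
    (summable_cone_odd h0 h1 hg) (by rw [e]; exact hs)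
  rw [e, tsum_prod_swap fun r s => g (-1 - (r + s)) (r - s)] at h
  exact h

/-- The odd part of the indefinite sum of `g` is a Hecke-type sum, with `n = -1 - r - s` and
`j = s - r`. -/
theorem f_eq_odd_swap {x y q k : ℂ} (hk : k ≠ 0) (h0 : 0 < ρ) (h1 : ρ < 1)
    (hg : ∀ n j : ℤ, 0 ≤ n + j → 0 ≤ n - j → ‖g n j‖ ≤ ρ ^ n)
    (hg' : ∀ n j : ℤ, 0 ≤ n + j → 0 ≤ n - j → ‖g (-1 - n) j‖ ≤ ρ ^ n)
    (hT : ∀ r s : ℤ, k * ((-1) ^ (r + s) * x ^ r * y ^ s *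
      q ^ (1 * (r * (r - 1) / 2) + 7 * r * s + 1 * (s * (s - 1) / 2))) =
        -g (-1 - (r + s)) (s - r)) :
    Summable (fTerm 1 7 1 x y q) ∧ k * f 1 7 1 x y q =
      ∑' p : ℕ × ℕ, g (p.1 + p.2 + 1) (p.1 - p.2) -
        ∑' p : ℕ × ℕ, g (-1 - (p.1 + p.2)) (p.1 - p.2) := by
  have e : (fun p : ℕ × ℕ => -g (-1 - ((-p.1 - 1) + (-p.2 - 1))) ((-p.2 - 1) - (-p.1 - 1))) =
      fun p : ℕ × ℕ => -g (p.1 + p.2 + 1) (p.1 - p.2) := by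
    ext p; congr 2 <;> ring
  have e' : (fun p : ℕ × ℕ => -g (-1 - (p.1 + p.2)) (p.2 - p.1)) =
      fun p : ℕ × ℕ => -g (-1 - (p.2 + p.1)) (p.2 - p.1) := by
    ext p; rw [add_comm (p.1 : ℤ)]
  have hs := summable_prod_swap (h := fun r s => g (-1 - (r + s)) (r - s))
    (summable_cone_even (g := fun n j => g (-1 - n) j) h0 h1 hg')
  have h := hasSum_fTerm (T := fun r s => -g (-1 - (r + s)) (s - r)) hk hT
    (by rw [e']; exact hs.neg) (by rw [e]; exact (summable_cone_odd h0 h1 hg).neg)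
  rw [e, e', tsum_neg, tsum_neg, tsum_prod_swap fun r s => g (-1 - (r + s)) (r - s)] at h
  exact ⟨h.1, by rw [h.2]; ring⟩

end Assembly

/-! ### Matching exponents, and the double-sum identities -/

theorem mul_three_mul_sub_one_ediv_two (j : ℤ) : j * (3 * j - 1) / 2 = j ^ 2 + tri j := by
  apply Int.ediv_eq_of_eq_mul_right (by norm_num)
  linear_combination -two_mul_tri j

theorem neg_one_zpow_add (m n : ℤ) : (-1 : ℂ) ^ (m + n) = (-1) ^ m * (-1) ^ n :=
  zpow_add₀ (by norm_num) m n

theorem neg_one_zpow_sub (m n : ℤ) : (-1 : ℂ) ^ (m - n) = (-1) ^ m * (-1) ^ n := by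
  rw [zpow_sub₀ (by norm_num), div_eq_mul_inv, ← inv_zpow, inv_neg_one]

theorem neg_one_zpow_mul_self (m : ℤ) : (-1 : ℂ) ^ m * (-1) ^ m = 1 := by
  rw [← mul_zpow]; simp

theorem norm_neg_one_zpow_mul_zpow_le {q : ℂ} (hq0 : q ≠ 0) (hq1 : ‖q‖ < 1) {m n k : ℤ}
    (h : n ≤ k) : ‖(-1) ^ m * q ^ k‖ ≤ ‖q‖ ^ n := by
  rw [norm_mul, norm_zpow, norm_zpow, norm_neg, norm_one, one_zpow, one_mul]
  exact zpow_le_zpow_right_of_le_one₀ (norm_pos_iff.mpr hq0) hq1.le h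

theorem hecke_term_neg {q : ℂ} (hq0 : q ≠ 0) (a b : ℕ) (r s : ℤ) :
    (-1) ^ (r + s) * (-q ^ a) ^ r * (-q ^ b) ^ s *
      q ^ (1 * (r * (r - 1) / 2) + 7 * r * s + 1 * (s * (s - 1) / 2)) =
      q ^ (a * r + b * s + tri r + 7 * r * s + tri s) := by
  have e : a * r + b * s + tri r + 7 * r * s + tri s = a * r + (b * s +
      (1 * (r * (r - 1) / 2) + 7 * r * s + 1 * (s * (s - 1) / 2))) := by
    simp only [tri]; ring
  rw [e]
  generalize 1 * (r * (r - 1) / 2) + 7 * r * s + 1 * (s * (s - 1) / 2) = d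
  rw [neg_eq_neg_one_mul (q ^ a), neg_eq_neg_one_mul (q ^ b), mul_zpow, mul_zpow,
    neg_one_zpow_add, ← zpow_natCast q a, ← zpow_natCast q b, ← zpow_mul, ← zpow_mul,
    zpow_add₀ hq0, zpow_add₀ hq0]
  linear_combination (q ^ ((a : ℤ) * r) * (q ^ ((b : ℤ) * s) * q ^ d)) *
    ((-1 : ℂ) ^ s * (-1) ^ s * neg_one_zpow_mul_self r + neg_one_zpow_mul_self s)

theorem hecke_term_sq {q : ℂ} (hq0 : q ≠ 0) (a b : ℕ) (r s : ℤ) :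
    (-1) ^ (r + s) * (q ^ a) ^ r * (q ^ b) ^ s *
      (q ^ 2) ^ (1 * (r * (r - 1) / 2) + 7 * r * s + 1 * (s * (s - 1) / 2)) =
      (-1) ^ (r + s) * q ^ (a * r + b * s + r * (r - 1) + 14 * r * s + s * (s - 1)) := by
  rw [← zpow_natCast q a, ← zpow_natCast q b, ← zpow_natCast q 2, ← zpow_mul, ← zpow_mul, ← zpow_mul,
    mul_assoc, mul_assoc, ← zpow_add₀ hq0, ← zpow_add₀ hq0]
  congr 2
  have h1 := two_mul_tri r
  have h2 := two_mul_tri s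
  simp only [tri] at h1 h2
  push_cast
  linear_combination h1 + h2

/-- The summand of the indefinite theta series of `φ` (`m = 1`) and of `ν` (`m = 2`). -/
noncomputable def thetaTerm (q : ℂ) (m : ℕ) (n j : ℤ) : ℂ :=
  (-1) ^ (n + j) * q ^ (2 * n ^ 2 + m * n - j * (3 * j - 1) / 2)

theorem norm_thetaTerm_le {q : ℂ} (hq0 : q ≠ 0) (hq1 : ‖q‖ < 1) {m : ℕ} (hm : 1 ≤ m) (n j : ℤ)
    (h1 : 0 ≤ n + j) (h2 : 0 ≤ n - j) : ‖thetaTerm q m n j‖ ≤ ‖q‖ ^ n := by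
  refine norm_neg_one_zpow_mul_zpow_le hq0 hq1 ?_
  rw [mul_three_mul_sub_one_ediv_two]
  have hn : 0 ≤ n := by omega
  have hm' : (1 : ℤ) ≤ m := by exact_mod_cast hm
  nlinarith [two_mul_tri j, mul_nonneg h1 h2, Int.le_self_sq n, mul_le_mul_of_nonneg_right hm' hn]

theorem norm_thetaTerm_reflect_le {q : ℂ} (hq0 : q ≠ 0) (hq1 : ‖q‖ < 1) {m : ℕ} (hm : m ≤ 2)
    (n j : ℤ) (h1 : 0 ≤ n + j) (h2 : 0 ≤ n - j) : ‖thetaTerm q m (-1 - n) j‖ ≤ ‖q‖ ^ n := by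
  refine norm_neg_one_zpow_mul_zpow_le hq0 hq1 ?_
  rw [mul_three_mul_sub_one_ediv_two]
  have hn : 0 ≤ n := by omega
  have hm' : (m : ℤ) ≤ 2 := by exact_mod_cast hm
  nlinarith [two_mul_tri j, mul_nonneg h1 h2, Int.le_self_sq n, mul_le_mul_of_nonneg_right hm' hn]

theorem hecke_term_eq_thetaTerm {q : ℂ} (hq0 : q ≠ 0) (m : ℕ) (r s : ℤ) :
    (-1) ^ (r + s) * (-q ^ m) ^ r * (-q ^ (m + 1)) ^ s *
      q ^ (1 * (r * (r - 1) / 2) + 7 * r * s + 1 * (s * (s - 1) / 2)) =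
        thetaTerm q m (r + s) (s - r) := by
  rw [hecke_term_neg hq0, thetaTerm, show r + s + (s - r) = s + s by ring, neg_one_zpow_add,
    neg_one_zpow_mul_self, one_mul, mul_three_mul_sub_one_ediv_two]
  congr 1
  have h : 2 * (m * r + ((m + 1 : ℕ) : ℤ) * s + tri r + 7 * r * s + tri s) =
      2 * (2 * (r + s) ^ 2 + m * (r + s) - ((s - r) ^ 2 + tri (s - r))) := by
    push_cast
    linear_combination two_mul_tri r + two_mul_tri s + two_mul_tri (s - r)
  linarith

/-- The substitution n = -1-r-s matches the linear terms of the exponent, whereas n = r+s+1 does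
not. It sends the positive quadrant into the negative cone, and (-1)^{n+j} = -1 supplies the sign
with which that cone enters. -/
theorem hecke_term_eq_neg_thetaTerm {q : ℂ} (hq0 : q ≠ 0) (r s : ℤ) :
    q * ((-1) ^ (r + s) * (-q ^ 3) ^ r * (-q ^ 4) ^ s *
      q ^ (1 * (r * (r - 1) / 2) + 7 * r * s + 1 * (s * (s - 1) / 2))) =
        -thetaTerm q 1 (-1 - (r + s)) (s - r) := by
  rw [hecke_term_neg hq0, thetaTerm, show -1 - (r + s) + (s - r) = -1 - (r + r) by ring,
    neg_one_zpow_sub, neg_one_zpow_add, neg_one_zpow_mul_self, mul_three_mul_sub_one_ediv_two,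
    ← zpow_one_add₀ hq0]
  have h : 2 * (1 + (((3 : ℕ) : ℤ) * r + ((4 : ℕ) : ℤ) * s + tri r + 7 * r * s + tri s)) =
      2 * (2 * (-1 - (r + s)) ^ 2 + ((1 : ℕ) : ℤ) * (-1 - (r + s)) -
        ((s - r) ^ 2 + tri (s - r))) := by
    push_cast
    linear_combination two_mul_tri r + two_mul_tri s + two_mul_tri (s - r)
  rw [mul_left_cancel₀ two_ne_zero h]
  simp

theorem phi_identities {q : ℂ} (hq0 : q ≠ 0) (hq1 : ‖q‖ < 1) :
    HasIndefSum (thetaTerm q 1) (Jbar 1 4 q * phi q) ∧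
      Summable (fTerm 1 7 1 (-q) (-q ^ 2) q) ∧ Summable (fTerm 1 7 1 (-q ^ 3) (-q ^ 4) q) ∧
      Jbar 1 4 q * phi q = f 1 7 1 (-q) (-q ^ 2) q + q * f 1 7 1 (-q ^ 3) (-q ^ 4) q := by
  have h0 : 0 < ‖q‖ := norm_pos_iff.mpr hq0
  have hg := norm_thetaTerm_le hq0 hq1 (m := 1) le_rfl
  have hg' := norm_thetaTerm_reflect_le hq0 hq1 (m := 1) one_le_two
  obtain ⟨s1, e1⟩ := f_eq_even_swap h0 hq1 hg hg' (hecke_term_eq_thetaTerm hq0 1)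
  obtain ⟨s2, e2⟩ := f_eq_odd_swap hq0 h0 hq1 hg hg' (hecke_term_eq_neg_thetaTerm hq0)
  have hi := hasIndefSum_of_norm_le h0 hq1 hg hg'
  -- Reflection raises the exponent 2n² + n by 2n + 1 and flips the sign (-1)^n, so subtracting it
  -- produces the factor 1 + q^{2n+1}.
  have hS := (hasSum_blocks h0 hq1 hg hg').unique <| (hasSum_phi hq0 hq1).congr_fun fun n => by
    rw [innerA, Finset.mul_sum]
    refine Finset.sum_congr rfl fun j _ => ?_
    rw [thetaTerm, thetaTerm, show 2 * (n : ℤ) ^ 2 + (1 : ℕ) * n - j * (3 * j - 1) / 2 =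
        ((2 * n ^ 2 + n : ℕ) : ℤ) + -(j * (3 * j - 1) / 2) by push_cast; ring,
      show 2 * (-1 - (n : ℤ)) ^ 2 + (1 : ℕ) * (-1 - n) - j * (3 * j - 1) / 2 =
        ((2 * n ^ 2 + n + (2 * n + 1) : ℕ) : ℤ) + -(j * (3 * j - 1) / 2) by push_cast; ring,
      zpow_add₀ hq0, zpow_add₀ hq0, neg_one_zpow_add, neg_one_zpow_add, neg_one_zpow_sub,
      zpow_natCast, zpow_natCast, zpow_natCast, pow_add q (2 * n ^ 2 + n)]
    simp only [Int.reduceNeg, zpow_neg_one, inv_neg_one]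
    ring
  rw [hS] at hi
  rw [pow_one] at s1 e1
  exact ⟨hi, s1, s2, by rw [e1, e2, ← hS]; ring⟩

/-- The exponent 2n² + 2n is invariant under n ↦ -1-n while the sign changes. The two cones thus
contribute equally, which explains the factor 1/2, and one sum f_{1,7,1} already covers both parity
pieces of the cone. -/
theorem thetaTerm_two_reflect (q : ℂ) (n j : ℤ) :
    thetaTerm q 2 (-1 - n) j = -thetaTerm q 2 n j := by
  rw [thetaTerm, thetaTerm, neg_one_zpow_add, neg_one_zpow_add, neg_one_zpow_sub,
    show 2 * (-1 - n) ^ 2 + ((2 : ℕ) : ℤ) * (-1 - n) = 2 * n ^ 2 + ((2 : ℕ) : ℤ) * n by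
      push_cast; ring]
  simp

theorem nu_identities {q : ℂ} (hq0 : q ≠ 0) (hq1 : ‖q‖ < 1) :
    HasIndefSum (thetaTerm q 2) (2 * (Jbar 1 4 q * nu q)) ∧
      Summable (fTerm 1 7 1 (-q ^ 2) (-q ^ 3) q) ∧
      Jbar 1 4 q * nu q = f 1 7 1 (-q ^ 2) (-q ^ 3) q := by
  have h0 : 0 < ‖q‖ := norm_pos_iff.mpr hq0
  have hg := norm_thetaTerm_le hq0 hq1 (m := 2) one_le_two
  have hg' := norm_thetaTerm_reflect_le hq0 hq1 (m := 2) le_rfl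
  obtain ⟨s1, e1⟩ := f_eq_even_swap h0 hq1 hg hg' (hecke_term_eq_thetaTerm hq0 2)
  have hi := hasIndefSum_of_norm_le h0 hq1 hg hg'
  have hS := (hasSum_cone_fiberwise h0 hq1 hg).unique <| (hasSum_nu hq0 hq1).congr_fun fun n => by
    rw [innerA, Finset.mul_sum]
    refine Finset.sum_congr rfl fun j _ => ?_
    rw [thetaTerm, show 2 * (n : ℤ) ^ 2 + (2 : ℕ) * n - j * (3 * j - 1) / 2 =
        ((2 * n ^ 2 + 2 * n : ℕ) : ℤ) + -(j * (3 * j - 1) / 2) by push_cast; ring,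
      zpow_add₀ hq0, neg_one_zpow_add, zpow_natCast, zpow_natCast]
    ring
  simp only [thetaTerm_two_reflect, tsum_neg] at hi e1
  rw [sub_neg_eq_add, hS] at e1
  refine ⟨?_, s1, e1.symm⟩
  convert hi using 1
  rw [← hS]
  ring

/-- The summand of the indefinite theta series of `φ̄₀` (`m = 1`) and of `φ̄₁` (`m = 3`). -/
noncomputable def thetaBarTerm (q : ℂ) (m : ℕ) (n j : ℤ) : ℂ :=
  (-1) ^ j * q ^ (4 * n ^ 2 + m * n - 3 * j ^ 2 - j)

/-- An indefinite theta series `∑* (-1)^j q^{4n² + mn - 3j² - j}` as a sum of two Hecke-type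
double sums. -/
theorem thetaBar_identities {q S : ℂ} (hq0 : q ≠ 0) (hq1 : ‖q‖ < 1) {m k : ℕ} (hm : 1 ≤ m)
    (hk : m + k = 4)
    (hS : HasSum (fun n : ℕ => q ^ (4 * n ^ 2 + m * n) * (1 - q ^ (2 * k * n + k)) * innerB q n) S) :
    HasIndefSum (thetaBarTerm q m) S ∧ Summable (fTerm 1 7 1 (q ^ m) (q ^ (m + 2)) (q ^ 2)) ∧
      Summable (fTerm 1 7 1 (q ^ (m + 8)) (q ^ (m + 10)) (q ^ 2)) ∧
      S = f 1 7 1 (q ^ m) (q ^ (m + 2)) (q ^ 2) +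
        q ^ (m + 4) * f 1 7 1 (q ^ (m + 8)) (q ^ (m + 10)) (q ^ 2) := by
  have h0 : 0 < ‖q‖ := norm_pos_iff.mpr hq0
  have hm1 : (1 : ℤ) ≤ m := by exact_mod_cast hm
  -- Reflection raises 4n² + mn by 2(4-m)n + (4-m); hence k = 4 - m and the factor 1 - q^{2kn+k}.
  have hk' : (m : ℤ) = 4 - k := by omega
  have hg : ∀ n j : ℤ, 0 ≤ n + j → 0 ≤ n - j → ‖thetaBarTerm q m n j‖ ≤ ‖q‖ ^ n := by
    intro n j h1 h2
    have hn : 0 ≤ n := by omega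
    refine norm_neg_one_zpow_mul_zpow_le hq0 hq1 ?_
    nlinarith [mul_nonneg h1 h2, Int.le_self_sq n, mul_le_mul_of_nonneg_right hm1 hn]
  have hg' : ∀ n j : ℤ, 0 ≤ n + j → 0 ≤ n - j → ‖thetaBarTerm q m (-1 - n) j‖ ≤ ‖q‖ ^ n := by
    intro n j h1 h2
    have hn : 0 ≤ n := by omega
    have hm2 : (m : ℤ) ≤ 4 := by omega
    refine norm_neg_one_zpow_mul_zpow_le hq0 hq1 ?_
    nlinarith [mul_nonneg h1 h2, Int.le_self_sq n, mul_le_mul_of_nonneg_right hm2 hn]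
  obtain ⟨s1, e1⟩ := f_eq_even (x := q ^ m) (y := q ^ (m + 2)) (q := q ^ 2) h0 hq1 hg hg'
    fun r s => by
      rw [hecke_term_sq hq0, thetaBarTerm, neg_one_zpow_add, neg_one_zpow_sub]
      congr 2
      push_cast
      ring
  obtain ⟨s2, e2⟩ := f_eq_odd (x := q ^ (m + 8)) (y := q ^ (m + 10)) (q := q ^ 2)
    (pow_ne_zero (m + 4) hq0) h0 hq1 hg hg' fun r s => by
      rw [hecke_term_sq hq0, thetaBarTerm, neg_one_zpow_add, neg_one_zpow_sub, mul_left_comm,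
        ← zpow_natCast q (m + 4), ← zpow_add₀ hq0]
      congr 2
      push_cast
      ring
  have hi := hasIndefSum_of_norm_le h0 hq1 hg hg'
  have hS' := (hasSum_blocks h0 hq1 hg hg').unique <| hS.congr_fun fun n => by
    rw [innerB, Finset.mul_sum]
    refine Finset.sum_congr rfl fun j _ => ?_
    rw [thetaBarTerm, thetaBarTerm, show 4 * (n : ℤ) ^ 2 + m * n - 3 * j ^ 2 - j =
        ((4 * n ^ 2 + m * n : ℕ) : ℤ) + (-3 * j ^ 2 - j) by push_cast; ring,
      show 4 * (-1 - (n : ℤ)) ^ 2 + m * (-1 - n) - 3 * j ^ 2 - j =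
        ((4 * n ^ 2 + m * n + (2 * k * n + k) : ℕ) : ℤ) + (-3 * j ^ 2 - j) by
          push_cast; rw [hk']; ring,
      zpow_add₀ hq0, zpow_add₀ hq0, zpow_natCast, zpow_natCast, pow_add q (4 * n ^ 2 + m * n)]
    ring
  rw [hS'] at hi
  exact ⟨hi, s1, s2, by rw [e1, e2, ← hS']; ring⟩

end HeckeMock

theorem theorem1p5 (q : ℂ) (hq0 : q ≠ 0) (hq1 : ‖q‖ < 1) :
    -- the identities for `φ`
    (Summable (HeckeMock.phiTerm q) ∧
      HasSum (fun n : ℕ => (-1) ^ n * q ^ (2 * n ^ 2 + n) * (1 + q ^ (2 * n + 1)) *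
        HeckeMock.innerA q n) (HeckeMock.Jbar 1 4 q * HeckeMock.phi q) ∧
      HeckeMock.HasIndefSum
        (fun n j => (-1) ^ (n + j) * q ^ (2 * n ^ 2 + n - j * (3 * j - 1) / 2))
        (HeckeMock.Jbar 1 4 q * HeckeMock.phi q) ∧
      Summable (HeckeMock.fTerm 1 7 1 (-q) (-q ^ 2) q) ∧
      Summable (HeckeMock.fTerm 1 7 1 (-q ^ 3) (-q ^ 4) q) ∧
      HeckeMock.Jbar 1 4 q * HeckeMock.phi q =
        HeckeMock.f 1 7 1 (-q) (-q ^ 2) q + q * HeckeMock.f 1 7 1 (-q ^ 3) (-q ^ 4) q) ∧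
    -- the identities for `ν`
    (Summable (HeckeMock.nuTerm q) ∧
      HasSum (fun n : ℕ => (-1) ^ n * q ^ (2 * n ^ 2 + 2 * n) * HeckeMock.innerA q n)
        (HeckeMock.Jbar 1 4 q * HeckeMock.nu q) ∧
      (∃ S : ℂ, HeckeMock.HasIndefSum
        (fun n j => (-1) ^ (n + j) * q ^ (2 * n ^ 2 + 2 * n - j * (3 * j - 1) / 2)) S ∧
        HeckeMock.Jbar 1 4 q * HeckeMock.nu q = 1 / 2 * S) ∧
      Summable (HeckeMock.fTerm 1 7 1 (-q ^ 2) (-q ^ 3) q) ∧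
      HeckeMock.Jbar 1 4 q * HeckeMock.nu q = HeckeMock.f 1 7 1 (-q ^ 2) (-q ^ 3) q) ∧
    -- the identities for `φ̄₀`
    (Summable (HeckeMock.phibar0Term q) ∧
      HasSum (fun n : ℕ => q ^ (4 * n ^ 2 + n) * (1 - q ^ (6 * n + 3)) * HeckeMock.innerB q n)
        (HeckeMock.J 1 2 q * (q * HeckeMock.phibar0 q + 1)) ∧
      HeckeMock.HasIndefSum
        (fun n j => (-1) ^ j * q ^ (4 * n ^ 2 + n - 3 * j ^ 2 - j))
        (HeckeMock.J 1 2 q * (q * HeckeMock.phibar0 q + 1)) ∧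
      Summable (HeckeMock.fTerm 1 7 1 q (q ^ 3) (q ^ 2)) ∧
      Summable (HeckeMock.fTerm 1 7 1 (q ^ 9) (q ^ 11) (q ^ 2)) ∧
      HeckeMock.J 1 2 q * (q * HeckeMock.phibar0 q + 1) =
        HeckeMock.f 1 7 1 q (q ^ 3) (q ^ 2) +
          q ^ 5 * HeckeMock.f 1 7 1 (q ^ 9) (q ^ 11) (q ^ 2)) ∧
    -- the identities for `φ̄₁`
    (Summable (HeckeMock.phibar1Term q) ∧
      HasSum (fun n : ℕ => q ^ (4 * n ^ 2 + 3 * n) * (1 - q ^ (2 * n + 1)) *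
        HeckeMock.innerB q n) (HeckeMock.J 1 2 q * HeckeMock.phibar1 q) ∧
      HeckeMock.HasIndefSum
        (fun n j => (-1) ^ j * q ^ (4 * n ^ 2 + 3 * n - 3 * j ^ 2 - j))
        (HeckeMock.J 1 2 q * HeckeMock.phibar1 q) ∧
      Summable (HeckeMock.fTerm 1 7 1 (q ^ 3) (q ^ 5) (q ^ 2)) ∧
      Summable (HeckeMock.fTerm 1 7 1 (q ^ 11) (q ^ 13) (q ^ 2)) ∧
      HeckeMock.J 1 2 q * HeckeMock.phibar1 q =
        HeckeMock.f 1 7 1 (q ^ 3) (q ^ 5) (q ^ 2) +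
          q ^ 7 * HeckeMock.f 1 7 1 (q ^ 11) (q ^ 13) (q ^ 2)) := by
  obtain ⟨a1, a2, a3, a4⟩ := HeckeMock.phi_identities hq0 hq1
  obtain ⟨b1, b2, b3⟩ := HeckeMock.nu_identities hq0 hq1
  obtain ⟨c, c0⟩ := HeckeMock.bailey_phibar0 hq0 hq1
  obtain ⟨d, d0⟩ := HeckeMock.bailey_phibar1 hq0 hq1
  obtain ⟨c1, c2, c3, c4⟩ := HeckeMock.thetaBar_identities hq0 hq1 (m := 1) (k := 3) le_rfl rfl
    (by simpa only [one_mul] using c)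
  obtain ⟨d1, d2, d3, d4⟩ := HeckeMock.thetaBar_identities hq0 hq1 (m := 3) (k := 1) (by norm_num)
    rfl (by simpa only [mul_one] using d)
  have ea : HeckeMock.thetaTerm q 1 =
      fun n j => (-1) ^ (n + j) * q ^ (2 * n ^ 2 + n - j * (3 * j - 1) / 2) := by
    ext n j
    rw [HeckeMock.thetaTerm, Nat.cast_one, one_mul]
  have eb : HeckeMock.thetaTerm q 2 =
      fun n j => (-1) ^ (n + j) * q ^ (2 * n ^ 2 + 2 * n - j * (3 * j - 1) / 2) := by
    ext n j
    rw [HeckeMock.thetaTerm, Nat.cast_ofNat]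
  have ec : HeckeMock.thetaBarTerm q 1 =
      fun n j => (-1) ^ j * q ^ (4 * n ^ 2 + n - 3 * j ^ 2 - j) := by
    ext n j
    rw [HeckeMock.thetaBarTerm, Nat.cast_one, one_mul]
  have ed : HeckeMock.thetaBarTerm q 3 =
      fun n j => (-1) ^ j * q ^ (4 * n ^ 2 + 3 * n - 3 * j ^ 2 - j) := by
    ext n j
    rw [HeckeMock.thetaBarTerm, Nat.cast_ofNat]
  rw [ea] at a1
  rw [eb] at b1
  rw [ec] at c1
  rw [ed] at d1
  rw [pow_one] at c2 c4
  refine ⟨⟨(HeckeMock.hasSum_phiTerm hq1).summable, HeckeMock.hasSum_phi hq0 hq1, a1, a2, a3, a4⟩,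
    ⟨(HeckeMock.hasSum_nuTerm hq1).summable, HeckeMock.hasSum_nu hq0 hq1, ⟨_, b1, by ring⟩, b2, b3⟩,
    ⟨c0, c, c1, c2, c3, c4⟩, ⟨d0, d, d1, d2, d3, d4⟩⟩
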